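/- Let $N\ge 2$, $K=SU(N)$, $T\subset K$ the maximal torus of diagonal matrices, and let $\mathfrak h=\mathrm{Lie}(T\times S^1)$. For an affine root $\alpha=(e_p-e_q,k)$ ($p\neq q$, $k\in\mathbb Z$), regarded as the linear form $(X,y)\mapsto X_p-X_q+ky$ on $\mathfrak h=\{X\in\mathbb R^N:\sum_a X_a=0\}\oplus\mathbb R$, let $\Psi_\alpha:SU(2)\to LK$ send $\begin{pmatrix}a&-\bar b\\ b&\bar a\end{pmatrix}$ to the loop $u\mapsto\begin{pmatrix}a&-\bar b u^{k}\\ b u^{-k}&\bar a\end{pmatrix}$ in the $(p,q)$-block, and let $K_\alpha\subset LK$ be the subgroup of the loop group generated by $T$ and $\Psi_\alpha(SU(2))$. The affine simple roots are $\alpha_i=(e_i-e_{i+1},0)$ for $1\le i\le N-1$ and $\alpha_0=(e_N-e_1,1)$; put $K_{(i)}=K_{\alpha_i}$, and let the simple reflection $s_i$ act on $\mathfrak h^*$ by $s_i\lambda=\lambda-\langle\lambda,\alpha_i^\vee\rangle\alpha_i$, where $\alpha^\vee=(e_p-e_q,0)\in\mathfrak h$ for $\alpha=(e_p-e_q,k)$.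 For a word $w=s_{i_1}\cdots s_{i_n}$ (reduced or not), the Bott–Samelson manifold is $M_w=(K_{(i_1)}\times\cdots\times K_{(i_n)})/T^n$, where $(x_1,\dots,x_n)\cdot(t_1,\dots,t_n)=(x_1t_1,t_1^{-1}x_2t_2,\dots,t_{n-1}^{-1}x_nt_n)$. The torus $T\times S^1$ acts on it by $(t,\theta)\cdot[x_1,\dots,x_n]=[t\,(\theta\cdot x_1),\theta\cdot x_2,\dots,\theta\cdot x_n]$, with $(\theta\cdot x)(u)=x(u\theta)$. For $e\in\{0,1\}^n$ let $k_e=[k_1,\dots,k_n]\in M_w$, where $k_j=1$ if $e_j=0$ and $k_j=\dot s_{i_j}=\Psi_{\alpha_{i_j}}\begin{pmatrix}0&-1\\1&0\end{pmatrix}$ if $e_j=1$. The smooth structure of $M_w$ is given by the $2^n$ affine charts with inverses $$\Phi_e(z_1,\dots,z_n)=[\Psi_{\alpha_{i_1}}(m_{z_1}),\dots,\Psi_{\alpha_{i_n}}(m_{z_n})],\qquad \Phi_e(0)=k_e,$$ where $$m_{z_j}=\tfrac{1}{\sqrt{1+|z_j|^2}}\begin{pmatrix}1&-\bar z_j\\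 z_j&1\end{pmatrix}\ \text{ if } e_j=0,\qquad m_{z_j}=\tfrac{i}{\sqrt{1+|z_j|^2}}\begin{pmatrix}z_j&1\\1&-\bar z_j\end{pmatrix}\ \text{ if } e_j=1,$$ and $T_{k_e}M_w$ carries the complex structure given by the complex coordinates $z_1,\dots,z_n$ of the chart $\Phi_e$. Corollary. The point $k_e$ is fixed by $T\times S^1$. The isotropy representation of $T\times S^1$ on $T_{k_e}M_w$ (the differential of the action) is complex linear, and it is the direct sum of $n$ complex lines with weights $$\beta_j=s_{i_1}^{e_1}s_{i_2}^{e_2}\cdots s_{i_j}^{e_j}\cdot(-\alpha_{i_j}),\qquad j=1,\dots,n,$$ where a line has weight $\beta\in\mathfrak h^*$ if $\exp(X)$ acts on it by $e^{\sqrt{-1}\,\beta(X)}$ for all $X\in\mathfrak h$. The equivariant Euler class of $T_{k_e}M_w$, regarded as an equivariant complex vector bundle over the point, is $$\prod_{j=1}^n s_{i_1}^{e_1}\cdots s_{i_j}^{e_j}\cdot(-\alpha_{i_j})\ \in\ \mathrm{Sym}(\mathfrak h^*)=H^*_{T\times S^1}(\mathrm{pt};\mathbb R).$$ -/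

import Mathlib

open scoped Manifold ContDiff ComplexConjugate

noncomputable section

namespace BottSamelson

/-- The compact group `SU(N)`. -/
abbrev SU (N : ℕ) : Type := Matrix.specialUnitaryGroup (Fin N) ℂ

instance instIsTopologicalGroupSU (N : ℕ) : IsTopologicalGroup (SU N) where
  continuous_inv := Continuous.subtype_mk (continuous_subtype_val.star) _

/-- The maximal torus `T` of `SU(N)`: the diagonal matrices. -/
def maxTorus (N : ℕ) : Subgroup (SU N) where
  carrier := {g | g.1.IsDiag}
  mul_mem' := by
    intro a b ha hb
    have h1 := (Matrix.isDiag_iff_diagonal_diag _).1 ha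
    have h2 := (Matrix.isDiag_iff_diagonal_diag _).1 hb
    change (a.1 * b.1).IsDiag
    rw [← h1, ← h2, Matrix.diagonal_mul_diagonal]
    exact Matrix.isDiag_diagonal _
  one_mem' := Matrix.isDiag_one
  inv_mem' := by
    intro a ha
    exact Matrix.IsDiag.conjTranspose ha

/-- The free loop group `LK` of `K = SU(N)`, as continuous loops with the compact-open topology. The
subgroups used below consist of Laurent polynomial loops. -/
abbrev LoopGroup (N : ℕ) : Type := C(Circle, SU N)

/-- Constant loops. -/
def constLoop (N : ℕ) : SU N →* LoopGroup N where
  toFun g := ContinuousMap.const Circle g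
  map_one' := rfl
  map_mul' _ _ := rfl

/-- Rotation of loops: `(θ · f)(u) = f(uθ)`. -/
def rotate (N : ℕ) (θ : Circle) : LoopGroup N →* LoopGroup N where
  toFun f := f.comp ⟨fun u => u * θ, by fun_prop⟩
  map_one' := rfl
  map_mul' _ _ := rfl

/-- The datum of a real affine root `(e_p - e_q, k)`. -/
structure AffineRoot (N : ℕ) where
  p : Fin N
  q : Fin N
  ne : p ≠ q
  k : ℤ

/-- The matrix that has the block `(a, -b̄ u^k; b u^{-k}, ā)` in the rows and columns `p, q`, and is
the identity elsewhere. -/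
def rootMatrix {N : ℕ} (α : AffineRoot N) (a b : ℂ) (u : Circle) : Matrix (Fin N) (Fin N) ℂ :=
  Matrix.of fun r s =>
    if s = α.p then (if r = α.p then a else if r = α.q then b * (u : ℂ) ^ (-α.k) else 0)
    else if s = α.q then
      (if r = α.p then -conj b * (u : ℂ) ^ α.k else if r = α.q then conj a else 0)
    else if r = s then 1 else 0

section block

variable {N : ℕ} (α : AffineRoot N)

/-- The inclusion of the coordinates `p, q`. -/
def incl : Matrix (Fin N) (Fin 2) ℂ :=
  Matrix.of fun r j => if r = ![α.p, α.q] j then 1 else 0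

lemma incl_transpose_mul : (incl α).transpose * incl α = 1 := by
  have h := α.ne
  ext i j
  fin_cases i <;> fin_cases j <;> simp [incl, Matrix.mul_apply, h.symm]
  rw [Finset.sum_eq_single α.p] <;> simp +contextual

/-- A `2 × 2` block placed in the rows and columns `p, q`. -/
def blk (B : Matrix (Fin 2) (Fin 2) ℂ) : Matrix (Fin N) (Fin N) ℂ :=
  1 + incl α * ((B - 1) * (incl α).transpose)

lemma blk_mul (B C : Matrix (Fin 2) (Fin 2) ℂ) : blk α (B * C) = blk α B * blk α C := by
  have h := incl_transpose_mul α
  have e : incl α * ((B - 1) * (incl α).transpose) * (incl α * ((C - 1) * (incl α).transpose))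
      = incl α * (((B - 1) * (C - 1)) * (incl α).transpose) := by
    calc _ = incl α * ((B - 1) * (((incl α).transpose * incl α) *
              ((C - 1) * (incl α).transpose))) := by
            simp only [Matrix.mul_assoc]
      _ = _ := by rw [h, Matrix.one_mul, Matrix.mul_assoc]
  have e2 : B * C - 1 = (B - 1) * (C - 1) + (B - 1) + (C - 1) := by noncomm_ring
  unfold blk
  rw [add_mul, mul_add, mul_add, e, e2]
  simp only [Matrix.add_mul, Matrix.mul_add, Matrix.one_mul, Matrix.mul_one]
  abel

lemma blk_one : blk α 1 = 1 := by simp [blk]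

lemma blk_star (B : Matrix (Fin 2) (Fin 2) ℂ) : blk α (star B) = star (blk α B) := by
  have h : (incl α).conjTranspose = (incl α).transpose := by
    ext i j
    simp only [incl, Matrix.conjTranspose_apply, Matrix.of_apply, Matrix.transpose_apply]
    split_ifs <;> simp
  have h2 : (incl α).transpose.conjTranspose = incl α := by
    rw [← h, Matrix.conjTranspose_conjTranspose]
  simp [blk, Matrix.star_eq_conjTranspose, Matrix.conjTranspose_mul, h, h2, Matrix.mul_assoc]

lemma blk_det (B : Matrix (Fin 2) (Fin 2) ℂ) : (blk α B).det = B.det := by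
  unfold blk
  rw [Matrix.det_one_add_mul_comm, Matrix.mul_assoc, incl_transpose_mul]
  simp

lemma rootMatrix_eq (a b : ℂ) (u : Circle) :
    rootMatrix α a b u =
      blk α !![a, -conj b * (u : ℂ) ^ α.k; b * (u : ℂ) ^ (-α.k), conj a] := by
  have h := α.ne
  ext r s
  by_cases hs : s = α.p
  · by_cases hr : r = α.p
    · simp [rootMatrix, blk, incl, Matrix.mul_apply, Fin.sum_univ_two, hs, hr, h, h.symm]
    · by_cases hr2 : r = α.q <;>
      simp [rootMatrix, blk, incl, Matrix.mul_apply, Fin.sum_univ_two, hs, hr, h, h.symm, hr2]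
  · by_cases hs2 : s = α.q
    · by_cases hr : r = α.p
      · simp [rootMatrix, blk, incl, Matrix.mul_apply, Fin.sum_univ_two, hs2, hr, h, h.symm]
      · by_cases hr2 : r = α.q <;>
        simp [rootMatrix, blk, incl, Matrix.mul_apply, Fin.sum_univ_two, hr, h, h.symm, hr2, hs2]
    · simp [rootMatrix, blk, incl, Matrix.mul_apply, Fin.sum_univ_two, hs, hs2, Matrix.one_apply]

end block

lemma SU2_entries (A : SU 2) : A.1 0 1 = -conj (A.1 1 0) ∧ A.1 1 1 = conj (A.1 0 0) := by
  have h1 : star A.1 * A.1 = 1 := A.2.1.1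
  have h2 : A.1.det = 1 := A.2.2
  have h3 : A.1.adjugate = star A.1 := by
    have := A.1.mul_adjugate
    rw [h2, one_smul] at this
    calc A.1.adjugate = (star A.1 * A.1) * A.1.adjugate := by rw [h1, one_mul]
      _ = star A.1 := by rw [mul_assoc, this, mul_one]
  rw [Matrix.adjugate_fin_two] at h3
  have e00 := congrFun (congrFun h3 0) 0
  have e01 := congrFun (congrFun h3 0) 1
  simp [Matrix.star_apply] at e00 e01
  exact ⟨by rw [← e01, neg_neg], e00⟩

/-- A matrix `(a, -b̄; b, ā)` with `|a|² + |b|² = 1` as an element of `SU(2)`. -/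
def mkSU2 (a b : ℂ) (h : a * conj a + b * conj b = 1) : SU 2 :=
  ⟨!![a, -conj b; b, conj a], by
    rw [Matrix.mem_specialUnitaryGroup_iff]
    refine ⟨Matrix.mem_unitaryGroup_iff.2 ?_, ?_⟩
    · ext i j
      fin_cases i <;> fin_cases j <;>
        simp [Matrix.mul_apply, Fin.sum_univ_two, Matrix.star_apply]
      · rw [← h]; ring
      · ring
      · ring
      · rw [← h]; ring
    · rw [Matrix.det_fin_two_of, ← h]; ring⟩

lemma SU2_norm (A : SU 2) :
    A.1 0 0 * conj (A.1 0 0) + A.1 1 0 * conj (A.1 1 0) = 1 := by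
  have h2 : A.1.det = 1 := A.2.2
  rw [Matrix.det_fin_two, (SU2_entries A).1, (SU2_entries A).2] at h2
  rw [← h2]; ring

lemma conj_zpow_circle (u : Circle) (k : ℤ) : conj ((u : ℂ) ^ k) = (u : ℂ) ^ (-k) := by
  rw [map_zpow₀, ← Circle.coe_inv_eq_conj, Circle.coe_inv, inv_zpow, zpow_neg]

lemma zpow_circle_cancel (u : Circle) (k : ℤ) : (u : ℂ) ^ k * (u : ℂ) ^ (-k) = 1 := by
  rw [← zpow_add₀ (Circle.coe_ne_zero u)]; simp

lemma rootMatrix_mem {N : ℕ} (α : AffineRoot N) (A : SU 2) (u : Circle) :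
    rootMatrix α (A.1 0 0) (A.1 1 0) u ∈ Matrix.specialUnitaryGroup (Fin N) ℂ := by
  have hB := (mkSU2 (A.1 0 0) (A.1 1 0 * (u : ℂ) ^ (-α.k)) (by
    rw [map_mul, conj_zpow_circle, neg_neg]
    linear_combination SU2_norm A + A.1 1 0 * conj (A.1 1 0) * zpow_circle_cancel u α.k)).2
  have e : rootMatrix α (A.1 0 0) (A.1 1 0) u =
      blk α !![A.1 0 0, -conj (A.1 1 0 * (u : ℂ) ^ (-α.k));
        A.1 1 0 * (u : ℂ) ^ (-α.k), conj (A.1 0 0)] := by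
    rw [rootMatrix_eq, map_mul, conj_zpow_circle, neg_neg, neg_mul]
  rw [e, Matrix.mem_specialUnitaryGroup_iff]
  refine ⟨Matrix.mem_unitaryGroup_iff.2 ?_, ?_⟩
  · rw [← blk_star, ← blk_mul]
    have := Matrix.mem_unitaryGroup_iff.1 hB.1
    simp only [mkSU2] at this
    rw [this, blk_one]
  · rw [blk_det]; exact hB.2

/-- The embedding `Ψ_α : SU(2) → LK` attached to the affine root `α = (e_p - e_q, k)`: it sends
`(a, -b̄; b, ā)` to the loop `u ↦ (a, -b̄ u^k; b u^{-k}, ā)` in the `(p, q)`-block. -/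
def rootLoop {N : ℕ} (α : AffineRoot N) : SU 2 →* LoopGroup N where
  toFun A := 
    { toFun := fun u => ⟨rootMatrix α (A.1 0 0) (A.1 1 0) u, rootMatrix_mem α A u⟩
      continuous_toFun := by
        refine Continuous.subtype_mk (continuous_matrix fun r s => ?_) _
        have h : ∀ k : ℤ, Continuous fun u : Circle => (u : ℂ) ^ k := fun k =>
          Continuous.zpow₀ continuous_subtype_val k fun u => Or.inl (Circle.coe_ne_zero u)
        simp only [rootMatrix, Matrix.of_apply]
        split_ifs <;> first | exact continuous_const | exact continuous_const.mul (h _) }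
  map_one' := by
    ext u : 2
    change rootMatrix α 1 0 u = 1
    rw [rootMatrix_eq, ← blk_one α]
    congr 1
    ext i j; fin_cases i <;> fin_cases j <;> simp
  map_mul' A B := by
    ext u : 2
    change rootMatrix α ((A.1 * B.1) 0 0) ((A.1 * B.1) 1 0) u =
      rootMatrix α (A.1 0 0) (A.1 1 0) u * rootMatrix α (B.1 0 0) (B.1 1 0) u
    have hc := zpow_circle_cancel u α.k
    rw [rootMatrix_eq, rootMatrix_eq, rootMatrix_eq, ← blk_mul]
    congr 1
    have h1 := (SU2_entries A).1
    have h2 := (SU2_entries A).2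
    ext i j
    fin_cases i <;> fin_cases j <;>
      simp only [Matrix.mul_apply, Fin.sum_univ_two, h1, h2, Matrix.of_apply, Matrix.cons_val',
        Matrix.cons_val_zero, Matrix.cons_val_one, Fin.zero_eta, Fin.mk_one, Fin.isValue,
        map_add, map_mul, map_neg, Complex.conj_conj, Matrix.cons_val_fin_one]
    · linear_combination conj (A.1 1 0) * B.1 1 0 * hc
    · ring
    · ring
    · linear_combination (A.1 1 0) * conj (B.1 1 0) * hc

/-- The subgroup `K_α` of `LK` generated by the maximal torus `T` (constant loops) and the
`SU(2)` attached to `α`. -/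
def rootSubgroup {N : ℕ} (α : AffineRoot N) : Subgroup (LoopGroup N) :=
  Subgroup.closure ((constLoop N) '' (maxTorus N : Set (SU N)) ∪ Set.range (rootLoop α))

section structureK

variable {N : ℕ} (α : AffineRoot N)

lemma maxTorus_apply_ne {t : SU N} (ht : t ∈ maxTorus N) {r s : Fin N} (h : r ≠ s) :
    t.1 r s = 0 := ht h

lemma maxTorus_mul_left {t : SU N} (ht : t ∈ maxTorus N) (M : Matrix (Fin N) (Fin N) ℂ)
    (r s : Fin N) : (t.1 * M) r s = t.1 r r * M r s := by
  rw [Matrix.mul_apply, Finset.sum_eq_single r]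
  · intro b _ hb
    rw [maxTorus_apply_ne ht hb.symm, zero_mul]
  · simp

lemma maxTorus_mul_right {t : SU N} (ht : t ∈ maxTorus N) (M : Matrix (Fin N) (Fin N) ℂ)
    (r s : Fin N) : (M * t.1) r s = M r s * t.1 s s := by
  rw [Matrix.mul_apply, Finset.sum_eq_single s]
  · intro b _ hb
    rw [maxTorus_apply_ne ht hb, mul_zero]
  · simp

lemma maxTorus_conj {t : SU N} (ht : t ∈ maxTorus N) (r : Fin N) :
    t.1 r r * conj (t.1 r r) = 1 := by
  have h : t.1 * star t.1 = 1 := Matrix.mem_unitaryGroup_iff.1 t.2.1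
  have := congrFun (congrFun h r) r
  rw [maxTorus_mul_left ht] at this
  simpa [Matrix.star_apply] using this

lemma maxTorus_ne_zero {t : SU N} (ht : t ∈ maxTorus N) (r : Fin N) : t.1 r r ≠ 0 := by
  intro h
  have := maxTorus_conj ht r
  simp [h] at this

lemma constLoop_apply (t : SU N) (u : Circle) : constLoop N t u = t := rfl

lemma rootLoop_apply (A : SU 2) (u : Circle) :
    (rootLoop α A u).1 = rootMatrix α (A.1 0 0) (A.1 1 0) u := rfl

/-- The maximal torus normalizes the `SU(2)` of a root. -/
lemma const_mul_rootLoop {t : SU N} (ht : t ∈ maxTorus N) (A : SU 2) :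
    ∃ B : SU 2, constLoop N t * rootLoop α A = rootLoop α B * constLoop N t := by
  have hp := maxTorus_conj ht α.p
  have hq := maxTorus_conj ht α.q
  have hn := α.ne
  refine ⟨mkSU2 (A.1 0 0) (A.1 1 0 * (t.1 α.q α.q * conj (t.1 α.p α.p))) ?_, ?_⟩
  · simp only [map_mul, Complex.conj_conj]
    have h1 := SU2_norm A
    linear_combination h1 + A.1 1 0 * conj (A.1 1 0) * hp +
      A.1 1 0 * conj (A.1 1 0) * (t.1 α.p α.p * conj (t.1 α.p α.p)) * hq
  · ext u r s
    change (t.1 * rootMatrix α (A.1 0 0) (A.1 1 0) u) r s =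
      (rootMatrix α (A.1 0 0) (A.1 1 0 * (t.1 α.q α.q * conj (t.1 α.p α.p))) u * t.1) r s
    rw [maxTorus_mul_left ht, maxTorus_mul_right ht]
    simp only [rootMatrix, Matrix.of_apply]
    by_cases hs : s = α.p
    · by_cases hr : r = α.p
      · simp [hs, hr, mul_comm]
      · by_cases hr2 : r = α.q
        · simp [hs, hr2, hn.symm]
          linear_combination (-t.1 α.q α.q * A.1 1 0 * ((u : ℂ) ^ α.k)⁻¹) * hp
        · simp [hs, hr, hr2]
    · by_cases hs2 : s = α.q
      · by_cases hr : r = α.p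
        · simp [hs2, hr, hn.symm]
          linear_combination (-conj (A.1 1 0) * (u : ℂ) ^ α.k * t.1 α.p α.p) * hq
        · by_cases hr2 : r = α.q
          · simp [hs2, hr2, hn.symm, mul_comm]
          · simp [hs2, hr, hr2, hn.symm]
      · by_cases hrs : r = s
        · subst hrs; simp [hs, hs2]
        · simp [hs, hs2, hrs]

lemma rootLoop_mem (A : SU 2) : rootLoop α A ∈ rootSubgroup α :=
  Subgroup.subset_closure (Or.inr ⟨A, rfl⟩)

lemma constLoop_mem {t : SU N} (ht : t ∈ maxTorus N) : constLoop N t ∈ rootSubgroup α :=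
  Subgroup.subset_closure (Or.inl ⟨t, ht, rfl⟩)

lemma exists_of_mem {f : LoopGroup N} (hf : f ∈ rootSubgroup α) :
    ∃ A : SU 2, ∃ t ∈ maxTorus N, f = rootLoop α A * constLoop N t := by
  induction hf using Subgroup.closure_induction with
  | mem x hx =>
    rcases hx with ⟨t, ht, rfl⟩ | ⟨A, rfl⟩
    · exact ⟨1, t, ht, by simp⟩
    · exact ⟨A, 1, one_mem _, by simp⟩
  | one => exact ⟨1, 1, one_mem _, by simp⟩
  | mul x y _ _ hx hy =>
    obtain ⟨A, t, ht, rfl⟩ := hx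
    obtain ⟨B, s, hs, rfl⟩ := hy
    obtain ⟨C, hC⟩ := const_mul_rootLoop α ht B
    refine ⟨A * C, t * s, mul_mem ht hs, ?_⟩
    rw [map_mul, map_mul, mul_assoc, ← mul_assoc (constLoop N t), hC]
    simp only [mul_assoc]
  | inv x _ hx =>
    obtain ⟨A, t, ht, rfl⟩ := hx
    obtain ⟨C, hC⟩ := const_mul_rootLoop α (inv_mem ht) A⁻¹
    refine ⟨C, t⁻¹, inv_mem ht, ?_⟩
    rw [mul_inv_rev, ← map_inv, ← map_inv, hC]

lemma rotate_mem (θ : Circle) {f : LoopGroup N} (hf : f ∈ rootSubgroup α) :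
    rotate N θ f ∈ rootSubgroup α := by
  have hc : ∀ t : SU N, rotate N θ (constLoop N t) = constLoop N t := fun _ => rfl
  obtain ⟨A, t, ht, rfl⟩ := exists_of_mem α hf
  rw [map_mul, hc]
  refine mul_mem ?_ (constLoop_mem α ht)
  have key : rotate N θ (rootLoop α A) =
      rootLoop α (mkSU2 (A.1 0 0) (A.1 1 0 * (θ : ℂ) ^ (-α.k)) (by
        rw [map_mul, conj_zpow_circle, neg_neg]
        linear_combination SU2_norm A + A.1 1 0 * conj (A.1 1 0) * zpow_circle_cancel θ α.k)) := by
    ext u r s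
    change rootMatrix α (A.1 0 0) (A.1 1 0) (u * θ) r s =
      rootMatrix α (A.1 0 0) (A.1 1 0 * (θ : ℂ) ^ (-α.k)) u r s
    simp only [rootMatrix, Matrix.of_apply, Circle.coe_mul, mul_zpow, map_mul, conj_zpow_circle,
      neg_neg]
    split_ifs <;> ring
  rw [key]
  exact rootLoop_mem α _

end structureK

/-- `1 / √(1 + |z|²)`. -/
def invNorm (z : ℂ) : ℂ := ((Real.sqrt (1 + Complex.normSq z))⁻¹ : ℝ)

lemma invNorm_conj (z : ℂ) : conj (invNorm z) = invNorm z := Complex.conj_ofReal _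

lemma one_add_normSq_pos (z : ℂ) : 0 < 1 + Complex.normSq z := by
  have := Complex.normSq_nonneg z
  linarith

lemma invNorm_ne_zero (z : ℂ) : invNorm z ≠ 0 := by
  have := Real.sqrt_pos.2 (one_add_normSq_pos z)
  simp only [invNorm, ne_eq, Complex.ofReal_eq_zero, inv_eq_zero]
  exact this.ne'

lemma invNorm_sq (z : ℂ) : invNorm z * invNorm z * (1 + z * conj z) = 1 := by
  have h := one_add_normSq_pos z
  have h2 : ((Real.sqrt (1 + Complex.normSq z))⁻¹ * (Real.sqrt (1 + Complex.normSq z))⁻¹ *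
      (1 + Complex.normSq z) : ℝ) = 1 := by
    rw [← mul_inv, Real.mul_self_sqrt h.le, inv_mul_cancel₀ h.ne']
  rw [Complex.mul_conj, invNorm]
  exact_mod_cast h2

/-- The matrices `m_z`: the affine charts of `SU(2)/T`, that is, of the complex projective line of
first columns `[a : b]`. For `c = 0` this is `(1 + |z|²)^(-1/2) (1, -z̄; z, 1)`, with coordinate
`z = b / a` centred at the class of `1`; for `c = 1` it is `i (1 + |z|²)^(-1/2) (z, 1; 1, -z̄)`, with
coordinate `z = a / b` centred at the class of the Weyl element. -/
def chartSU2 (c : Fin 2) (z : ℂ) : SU 2 :=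
  if c = 0 then
    mkSU2 (invNorm z) (invNorm z * z) (by
      rw [map_mul, invNorm_conj]; linear_combination invNorm_sq z)
  else
    mkSU2 (Complex.I * invNorm z * z) (Complex.I * invNorm z) (by
      simp only [map_mul, invNorm_conj, Complex.conj_I]
      linear_combination invNorm_sq z -
        invNorm z * invNorm z * (1 + z * conj z) * Complex.I_mul_I)

lemma chartSU2_zero_coe (z : ℂ) :
    (chartSU2 0 z).1 = invNorm z • !![1, -conj z; z, 1] := by
  ext i j
  fin_cases i <;> fin_cases j <;> simp [chartSU2, mkSU2, invNorm_conj]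

lemma chartSU2_one_coe (z : ℂ) :
    (chartSU2 1 z).1 = (Complex.I * invNorm z) • !![z, 1; 1, -conj z] := by
  ext i j
  fin_cases i <;> fin_cases j <;> simp [chartSU2, mkSU2, invNorm_conj]

section slope

variable {N : ℕ} (α : AffineRoot N)

/-- The entry of the first column of the `(p, q)`-block that has to be nonzero on the chart `c`. -/
def pivot (c : Fin 2) (g : SU N) : ℂ := if c = 0 then g.1 α.p α.p else g.1 α.q α.p

/-- The affine coordinate of the first column of the `(p, q)`-block in the chart `c`. -/
def slope (c : Fin 2) (g : SU N) : ℂ :=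
  if c = 0 then g.1 α.q α.p / g.1 α.p α.p else g.1 α.p α.p / g.1 α.q α.p

/-- The value at `u = 1` of `Ψ_α (m_z)`. -/
def sect (c : Fin 2) (z : ℂ) : SU N := rootLoop α (chartSU2 c z) 1

/-- What remains of `g` after splitting off `Ψ_α (m_z)`. -/
def resid (c : Fin 2) (g : SU N) : SU N := (sect α c (slope α c g))⁻¹ * g

lemma fin2_cases (c : Fin 2) : c = 0 ∨ c = 1 := by
  fin_cases c <;> simp

lemma rootLoop_one_pp (A : SU 2) : (rootLoop α A 1).1 α.p α.p = A.1 0 0 := by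
  simp [rootLoop_apply, rootMatrix]

lemma rootLoop_one_qp (A : SU 2) : (rootLoop α A 1).1 α.q α.p = A.1 1 0 := by
  simp [rootLoop_apply, rootMatrix, α.ne.symm]

lemma pivot_mul_right (c : Fin 2) (g : SU N) {t : SU N} (ht : t ∈ maxTorus N) :
    pivot α c (g * t) = pivot α c g * t.1 α.p α.p := by
  rcases fin2_cases c with rfl | rfl <;>
    simp [pivot, maxTorus_mul_right ht]

lemma pivot_mul_left (c : Fin 2) (g : SU N) {t : SU N} (ht : t ∈ maxTorus N) :
    pivot α c (t * g) ≠ 0 ↔ pivot α c g ≠ 0 := by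
  rcases fin2_cases c with rfl | rfl <;>
    simp [pivot, maxTorus_mul_left ht, maxTorus_ne_zero ht]

lemma slope_mul_right (c : Fin 2) (g : SU N) {t : SU N} (ht : t ∈ maxTorus N) :
    slope α c (g * t) = slope α c g := by
  have h := maxTorus_ne_zero ht α.p
  rcases fin2_cases c with rfl | rfl <;>
    simp [slope, maxTorus_mul_right ht, mul_div_mul_right _ _ h]

lemma resid_mul_right (c : Fin 2) (g : SU N) {t : SU N} (ht : t ∈ maxTorus N) :
    resid α c (g * t) = resid α c g * t := by
  rw [resid, slope_mul_right α c g ht, resid, mul_assoc]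

lemma slope_sect (c : Fin 2) (z : ℂ) : slope α c (sect α c z) = z := by
  have h := invNorm_ne_zero z
  rcases fin2_cases c with rfl | rfl <;>
    simp [slope, sect, rootLoop_one_pp, rootLoop_one_qp, chartSU2, mkSU2] <;> field_simp

lemma resid_sect (c : Fin 2) (z : ℂ) : resid α c (sect α c z) = 1 := by
  rw [resid, slope_sect, inv_mul_cancel]

lemma pivot_sect (c : Fin 2) (z : ℂ) : pivot α c (sect α c z) ≠ 0 := by
  have h := invNorm_ne_zero z
  rcases fin2_cases c with rfl | rfl <;>
    simp [pivot, sect, rootLoop_one_pp, rootLoop_one_qp, chartSU2, mkSU2, h]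

lemma rootLoop_of_diag (D : SU 2) (hD : D.1 1 0 = 0) :
    ∃ s ∈ maxTorus N, rootLoop α D = constLoop N s := by
  refine ⟨rootLoop α D 1, ?_, ?_⟩
  · intro r s hrs
    rw [rootLoop_apply, hD]
    simp only [rootMatrix, Matrix.of_apply]
    split_ifs <;> simp_all
  · ext u r s
    rw [constLoop_apply, rootLoop_apply, rootLoop_apply, hD]
    simp [rootMatrix]

/-- On the chart `c`, an element of `K_α` is `Ψ_α (m_z)` times a constant in the torus. -/
lemma exists_factor (c : Fin 2) {f : LoopGroup N} (hf : f ∈ rootSubgroup α)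
    (hp : pivot α c (f 1) ≠ 0) :
    resid α c (f 1) ∈ maxTorus N ∧
      f = rootLoop α (chartSU2 c (slope α c (f 1))) * constLoop N (resid α c (f 1)) := by
  obtain ⟨A, t, ht, rfl⟩ := exists_of_mem α hf
  have h1 : (rootLoop α A * constLoop N t) 1 = rootLoop α A 1 * t := rfl
  rw [h1] at hp ⊢
  rw [slope_mul_right α c _ ht, resid_mul_right α c _ ht]
  rw [pivot_mul_right α c _ ht] at hp
  have hp' := left_ne_zero_of_mul hp
  set z := slope α c (rootLoop α A 1) with hz
  have hD : ((chartSU2 c z)⁻¹ * A).1 1 0 = 0 := by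
    change (star (chartSU2 c z).1 * A.1) 1 0 = 0
    rcases fin2_cases c with rfl | rfl
    · simp only [pivot, if_true, rootLoop_one_pp] at hp'
      simp only [slope, if_true, rootLoop_one_pp, rootLoop_one_qp] at hz
      rw [chartSU2_zero_coe, Matrix.mul_apply, Fin.sum_univ_two]
      simp [Matrix.star_apply, invNorm_conj]
      rw [hz]; field_simp; ring
    · simp [pivot, rootLoop_one_qp] at hp'
      simp [slope, rootLoop_one_pp, rootLoop_one_qp] at hz
      rw [chartSU2_one_coe, Matrix.mul_apply, Fin.sum_univ_two]
      simp [Matrix.star_apply, invNorm_conj]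
      rw [hz]; field_simp; ring
  obtain ⟨s, hs, hDs⟩ := rootLoop_of_diag α _ hD
  have hA : rootLoop α A = rootLoop α (chartSU2 c z) * constLoop N s := by
    rw [← hDs, ← map_mul, mul_inv_cancel_left]
  have hr : resid α c (rootLoop α A 1) = s := by
    rw [resid, ← hz, hA]
    change (rootLoop α (chartSU2 c z) 1)⁻¹ * (rootLoop α (chartSU2 c z) 1 * s) = s
    rw [inv_mul_cancel_left]
  rw [hr]
  refine ⟨mul_mem hs ht, ?_⟩
  rw [map_mul, ← mul_assoc, ← hA]

end slope

section continuity

variable {N : ℕ}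

lemma continuous_entry (r s : Fin N) : Continuous fun g : SU N => g.1 r s :=
  (continuous_apply s).comp ((continuous_apply r).comp continuous_subtype_val)

lemma continuous_invNorm : Continuous invNorm := by
  unfold invNorm
  refine Complex.continuous_ofReal.comp (Continuous.inv₀ ?_ fun z =>
    (Real.sqrt_pos.2 (one_add_normSq_pos z)).ne')
  exact (continuous_const.add Complex.continuous_normSq).sqrt

lemma continuous_chartSU2 (c : Fin 2) : Continuous (chartSU2 c) := by
  have h := continuous_invNorm
  refine continuous_induced_rng.2 ?_
  rcases fin2_cases c with rfl | rfl
  · have : (Subtype.val ∘ chartSU2 0) = fun z => invNorm z • !![1, -conj z; z, 1] :=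
      funext chartSU2_zero_coe
    rw [this]
    refine continuous_matrix fun a b => ?_
    fin_cases a <;> fin_cases b <;> simp <;> fun_prop
  · have : (Subtype.val ∘ chartSU2 1) = fun z => (Complex.I * invNorm z) • !![z, 1; 1, -conj z] :=
      funext chartSU2_one_coe
    rw [this]
    refine continuous_matrix fun a b => ?_
    fin_cases a <;> fin_cases b <;> simp <;> fun_prop

lemma continuous_rootLoop (α : AffineRoot N) : Continuous (rootLoop α) := by
  refine ContinuousMap.continuous_of_continuous_uncurry _ ?_
  refine Continuous.subtype_mk (continuous_matrix fun r s => ?_) _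
  have h : ∀ k : ℤ, Continuous fun x : SU 2 × Circle => (x.2 : ℂ) ^ k := fun k =>
    Continuous.zpow₀ (continuous_subtype_val.comp continuous_snd) k
      fun u => Or.inl (Circle.coe_ne_zero u.2)
  have ha : Continuous fun x : SU 2 × Circle => x.1.1 0 0 :=
    (continuous_entry 0 0).comp continuous_fst
  have hb : Continuous fun x : SU 2 × Circle => x.1.1 1 0 :=
    (continuous_entry 1 0).comp continuous_fst
  simp only [rootMatrix, Matrix.of_apply]
  split_ifs
  · exact ha
  · exact hb.mul (h _)
  · exact continuous_const
  · exact (Complex.continuous_conj.comp hb).neg.mul (h _)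
  · exact Complex.continuous_conj.comp ha
  all_goals exact continuous_const

lemma continuous_sect (α : AffineRoot N) (c : Fin 2) : Continuous (sect α c) :=
  (ContinuousEvalConst.continuous_eval_const (1 : Circle)).comp
    ((continuous_rootLoop α).comp (continuous_chartSU2 c))

lemma continuousOn_slope (α : AffineRoot N) (c : Fin 2) :
    ContinuousOn (slope α c) {g | pivot α c g ≠ 0} := by
  rcases fin2_cases c with rfl | rfl
  · exact (continuous_entry _ _).continuousOn.div (continuous_entry _ _).continuousOn
      (fun g hg => by simpa [pivot] using hg)
  · exact (continuous_entry _ _).continuousOn.div (continuous_entry _ _).continuousOn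
      (fun g hg => by simpa [pivot] using hg)

lemma continuous_pivot (α : AffineRoot N) (c : Fin 2) : Continuous (pivot α c) := by
  rcases fin2_cases c with rfl | rfl
  · exact continuous_entry _ _
  · exact continuous_entry _ _

end continuity

/-- The affine simple roots of `SU(N)`, indexed by the residues `0, 1, …, N - 1`. With coordinates
numbered from `0`, one has `α_i = (e_{i-1} - e_i, 0)` for `i ≠ 0`, and
`α_0 = (e_{N-1} - e_0, 1) = (-∑_{i ≠ 0} α_i, 1)`; the subtraction `i - 1` is cyclic. -/
def simpleRoot {N : ℕ} [N.AtLeastTwo] (i : Fin N) : AffineRoot N where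
  p := i - 1
  q := i
  ne := by
    intro h
    have h1 : (1 : Fin N) = 0 := by
      have := sub_eq_self.1 h
      exact this
    have h2 : (1 : ℕ) % N = 0 % N := by
      have := congrArg Fin.val h1
      simpa [Fin.val_one'] using this
    have := Nat.AtLeastTwo.prop (n := N)
    rw [Nat.mod_eq_of_lt (by omega)] at h2
    simp at h2
  k := if i = 0 then 1 else 0

section BS

variable {N : ℕ} [N.AtLeastTwo] {n : ℕ} (i : Fin n → Fin N)

/-- The product `K_(i_1) × ⋯ × K_(i_n)`. -/
abbrev BSProd : Type := ∀ j : Fin n, rootSubgroup (simpleRoot (i j))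

/-- The orbit relation of the action of `T^n` on `K_(i_1) × ⋯ × K_(i_n)` by
`(x_1, …, x_n) · (t_1, …, t_n) = (x_1 t_1, t_1⁻¹ x_2 t_2, …, t_{n-1}⁻¹ x_n t_n)`; the torus elements
are written `t_0, t_1, …, t_n` with `t_0 = 1`. -/
def bsSetoid : Setoid (BSProd i) where
  r x y := ∃ t : Fin (n + 1) → maxTorus N, t 0 = 1 ∧ ∀ j : Fin n,
    (y j : LoopGroup N) =
      (constLoop N (t j.castSucc))⁻¹ * (x j : LoopGroup N) * constLoop N (t j.succ)
  iseqv :=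
    { refl := fun x => ⟨1, rfl, fun j => by simp⟩
      symm := by
        rintro x y ⟨t, h0, h⟩
        refine ⟨fun j => (t j)⁻¹, by simp [h0], fun j => ?_⟩
        rw [h j]
        simp only [Subgroup.coe_inv, map_inv]
        group
      trans := by
        rintro x y z ⟨t, h0, h⟩ ⟨s, g0, g⟩
        refine ⟨fun j => t j * s j, by simp [h0, g0], fun j => ?_⟩
        rw [g j, h j]
        simp only [Subgroup.coe_mul, map_mul]
        group }

/-- The Bott–Samelson manifold `M_w = (K_(i_1) × ⋯ × K_(i_n)) / T^n` of the word
`w = s_{i_1} ⋯ s_{i_n}`, with the quotient topology. -/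
def BSManifold : Type := Quotient (bsSetoid i)

instance instTopologicalSpaceBS : TopologicalSpace (BSManifold i) :=
  inferInstanceAs (TopologicalSpace (Quotient (bsSetoid i)))

/-- The class of a tuple. -/
def BSManifold.mk (x : BSProd i) : BSManifold i := Quotient.mk (bsSetoid i) x

variable {i}

/-- Evaluation of the components of a tuple at `u = 1`. -/
def evalOne (x : BSProd i) (j : Fin n) : SU N := (x j : LoopGroup N) 1

variable (i) in
/-- The torus elements split off successively by the affine coordinates. -/
def twist (e : Fin n → Fin 2) (g : Fin n → SU N) : Fin (n + 1) → SU N :=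
  Fin.induction (motive := fun _ => SU N) 1
    (fun j τ => resid (simpleRoot (i j)) (e j) (τ * g j))

variable (i) in
/-- The affine coordinates of a tuple. -/
def coords (e : Fin n → Fin 2) (g : Fin n → SU N) (j : Fin n) : ℂ :=
  slope (simpleRoot (i j)) (e j) (twist i e g j.castSucc * g j)

lemma twist_zero (e : Fin n → Fin 2) (g : Fin n → SU N) : twist i e g 0 = 1 := rfl

lemma twist_succ (e : Fin n → Fin 2) (g : Fin n → SU N) (j : Fin n) :
    twist i e g j.succ =
      resid (simpleRoot (i j)) (e j) (twist i e g j.castSucc * g j) := by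
  simp [twist]

lemma evalOne_rel {x y : BSProd i} {t : Fin (n + 1) → maxTorus N}
    (h : ∀ j : Fin n, (y j : LoopGroup N) =
      (constLoop N (t j.castSucc))⁻¹ * (x j : LoopGroup N) * constLoop N (t j.succ)) (j : Fin n) :
    evalOne y j = (t j.castSucc : SU N)⁻¹ * evalOne x j * t j.succ := by
  simp only [evalOne, h j]
  rfl

lemma twist_rel (e : Fin n → Fin 2) {x y : BSProd i} {t : Fin (n + 1) → maxTorus N} (h0 : t 0 = 1)
    (h : ∀ j : Fin n, (y j : LoopGroup N) =
      (constLoop N (t j.castSucc))⁻¹ * (x j : LoopGroup N) * constLoop N (t j.succ))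
    (j : Fin (n + 1)) : twist i e (evalOne y) j = twist i e (evalOne x) j * t j := by
  induction j using Fin.induction with
  | zero => simp [twist_zero, h0]
  | succ j ih =>
    rw [twist_succ, twist_succ, ih, evalOne_rel h, ← resid_mul_right _ _ _ (t j.succ).2]
    congr 1
    group

lemma coords_rel (e : Fin n → Fin 2) {x y : BSProd i} (h : (bsSetoid i).r x y) :
    coords i e (evalOne x) = coords i e (evalOne y) := by
  obtain ⟨t, h0, h⟩ := h
  funext j
  rw [coords, coords, twist_rel e h0 h, evalOne_rel h,
    ← slope_mul_right _ _ (_ * evalOne x j) (t j.succ).2]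
  congr 1
  group

lemma pivot_rel {x y : BSProd i} (h : (bsSetoid i).r x y) (j : Fin n) (c : Fin 2) :
    pivot (simpleRoot (i j)) c (evalOne x j) ≠ 0 ↔
      pivot (simpleRoot (i j)) c (evalOne y j) ≠ 0 := by
  obtain ⟨t, h0, h⟩ := h
  rw [evalOne_rel h, pivot_mul_right _ _ _ (t j.succ).2,
    mul_ne_zero_iff_right (maxTorus_ne_zero (t j.succ).2 _),
    pivot_mul_left _ _ _ (inv_mem (t j.castSucc).2)]

variable (i) in
/-- The map `(z_1, …, z_n) ↦ (Ψ_{α_{i_1}}(m_{z_1}), …, Ψ_{α_{i_n}}(m_{z_n}))`. -/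
def affineTuple (e : Fin n → Fin 2) (z : Fin n → ℂ) : BSProd i := fun j =>
  ⟨rootLoop (simpleRoot (i j)) (chartSU2 (e j) (z j)), rootLoop_mem _ _⟩

lemma evalOne_affineTuple (e : Fin n → Fin 2) (z : Fin n → ℂ) (j : Fin n) :
    evalOne (affineTuple i e z) j = sect (simpleRoot (i j)) (e j) (z j) := rfl

lemma twist_affineTuple (e : Fin n → Fin 2) (z : Fin n → ℂ) (j : Fin (n + 1)) :
    twist i e (evalOne (affineTuple i e z)) j = 1 := by
  induction j using Fin.induction with
  | zero => rfl
  | succ j ih => rw [twist_succ, ih, one_mul, evalOne_affineTuple, resid_sect]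

lemma coords_affineTuple (e : Fin n → Fin 2) (z : Fin n → ℂ) :
    coords i e (evalOne (affineTuple i e z)) = z := by
  funext j
  rw [coords, twist_affineTuple, one_mul, evalOne_affineTuple, slope_sect]

lemma twist_mem (e : Fin n → Fin 2) (x : BSProd i)
    (hx : ∀ j, pivot (simpleRoot (i j)) (e j) (evalOne x j) ≠ 0) (j : Fin (n + 1)) :
    twist i e (evalOne x) j ∈ maxTorus N := by
  induction j using Fin.induction with
  | zero => exact one_mem _
  | succ j ih =>
    rw [twist_succ]
    exact (exists_factor (simpleRoot (i j)) (e j)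
      (f := constLoop N (twist i e (evalOne x) j.castSucc) * (x j : LoopGroup N))
      (mul_mem (constLoop_mem _ ih) (x j).2) ((pivot_mul_left _ _ _ ih).2 (hx j))).1

lemma affineTuple_coords (e : Fin n → Fin 2) (x : BSProd i)
    (hx : ∀ j, pivot (simpleRoot (i j)) (e j) (evalOne x j) ≠ 0) :
    (bsSetoid i).r (affineTuple i e (coords i e (evalOne x))) x := by
  refine ⟨fun j => ⟨twist i e (evalOne x) j, twist_mem e x hx j⟩, rfl, fun j => ?_⟩
  have ih := twist_mem e x hx j.castSucc
  have := (exists_factor (simpleRoot (i j)) (e j)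
      (f := constLoop N (twist i e (evalOne x) j.castSucc) * (x j : LoopGroup N))
      (mul_mem (constLoop_mem _ ih) (x j).2) ((pivot_mul_left _ _ _ ih).2 (hx j))).2
  change constLoop N (twist i e (evalOne x) j.castSucc) * (x j : LoopGroup N) =
    rootLoop (simpleRoot (i j)) (chartSU2 (e j) (coords i e (evalOne x) j)) *
      constLoop N (resid (simpleRoot (i j)) (e j)
        (twist i e (evalOne x) j.castSucc * evalOne x j)) at this
  rw [← twist_succ] at this
  rw [mul_assoc]
  change _ = (constLoop N (twist i e (evalOne x) j.castSucc))⁻¹ *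
    (rootLoop (simpleRoot (i j)) (chartSU2 (e j) (coords i e (evalOne x) j)) *
      constLoop N (twist i e (evalOne x) j.succ))
  rw [← this, inv_mul_cancel_left]

lemma continuous_evalOne (j : Fin n) : Continuous fun x : BSProd i => evalOne x j := by
  unfold evalOne
  exact (ContinuousEvalConst.continuous_eval_const (1 : Circle)).comp
    (continuous_subtype_val.comp (continuous_apply j))

lemma continuous_affineTuple (e : Fin n → Fin 2) : Continuous (affineTuple i e) :=
  continuous_pi fun j => Continuous.subtype_mk
    ((continuous_rootLoop _).comp ((continuous_chartSU2 _).comp (continuous_apply j))) _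

variable (i) in
/-- The tuples on which the affine coordinates around the fixed point `e` are defined. -/
def tupleSource (e : Fin n → Fin 2) : Set (BSProd i) :=
  {x | ∀ j, pivot (simpleRoot (i j)) (e j) (evalOne x j) ≠ 0}

lemma continuousOn_twist (e : Fin n → Fin 2) (j : Fin (n + 1)) :
    ContinuousOn (fun x : BSProd i => twist i e (evalOne x) j) (tupleSource i e) := by
  induction j using Fin.induction with
  | zero => exact continuousOn_const
  | succ j ih =>
    have h1 := ih.mul (continuous_evalOne (i := i) j).continuousOn
    have h2 : ContinuousOn (fun x : BSProd i => slope (simpleRoot (i j)) (e j)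
        (twist i e (evalOne x) j.castSucc * evalOne x j)) (tupleSource i e) :=
      (continuousOn_slope _ _).comp h1 fun x hx =>
        (pivot_mul_left _ _ _ (twist_mem e x hx _)).2 (hx j)
    simp only [twist_succ]
    exact ((continuous_sect _ _).comp_continuousOn h2).inv.mul h1

lemma continuousOn_coords (e : Fin n → Fin 2) :
    ContinuousOn (fun x : BSProd i => coords i e (evalOne x)) (tupleSource i e) :=
  continuousOn_pi.2 fun j => (continuousOn_slope _ _).comp
    ((continuousOn_twist e j.castSucc).mul (continuous_evalOne (i := i) j).continuousOn)
    fun x hx => (pivot_mul_left _ _ _ (twist_mem e x hx _)).2 (hx j)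

lemma isOpen_tupleSource (e : Fin n → Fin 2) : IsOpen (tupleSource i e) := by
  have : tupleSource i e =
      ⋂ j, {x | pivot (simpleRoot (i j)) (e j) (evalOne x j) ≠ 0} := by
    ext x; simp [tupleSource]
  rw [this]
  exact isOpen_iInter_of_finite fun j =>
    isOpen_ne_fun ((continuous_pivot _ _).comp (continuous_evalOne j)) continuous_const

/-- The domain of the affine coordinates around the fixed point `e`. -/
def affineSource (e : Fin n → Fin 2) : Set (BSManifold i) :=
  {m | Quotient.liftOn m (fun x => x ∈ tupleSource i e) fun _ _ h =>
    propext (forall_congr' fun j => pivot_rel h j (e j))}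

lemma isOpen_affineSource (e : Fin n → Fin 2) : IsOpen (affineSource (i := i) e) :=
  isOpen_coinduced.2 (isOpen_tupleSource e)

/-- The affine coordinates around the fixed point `e`. -/
def affineCoord (e : Fin n → Fin 2) (m : BSManifold i) : Fin n → ℂ :=
  Quotient.liftOn m (fun x => coords i e (evalOne x)) fun _ _ h => coords_rel e h

variable (i) in
/-- The affine chart of `M_w` around the fixed point `e`. Its inverse is
`Φ_e : (z_1, …, z_n) ↦ [Ψ_{α_{i_1}}(m_{z_1}), …, Ψ_{α_{i_n}}(m_{z_n})]`. -/
def affineChart (e : Fin n → Fin 2) : OpenPartialHomeomorph (BSManifold i) (Fin n → ℂ) where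
  toFun := affineCoord e
  invFun z := BSManifold.mk i (affineTuple i e z)
  source := affineSource e
  target := Set.univ
  map_source' _ _ := Set.mem_univ _
  map_target' z _ := fun j => pivot_sect _ _ _
  left_inv' := by
    rintro ⟨x⟩ hx
    exact Quotient.sound (affineTuple_coords e x hx)
  right_inv' z _ := coords_affineTuple e z
  open_source := isOpen_affineSource e
  open_target := isOpen_univ
  continuousOn_toFun := by
    have hq : Topology.IsQuotientMap (BSManifold.mk i) := isQuotientMap_quotient_mk'
    exact (hq.continuousOn_isOpen_iff (isOpen_affineSource e)).2
      (continuousOn_coords e)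
  continuousOn_invFun :=
    (continuous_quotient_mk'.comp (continuous_affineTuple e)).continuousOn

end BS

section smooth

variable {N n : ℕ}

lemma pivot_one_of_zero (α : AffineRoot N) {f : LoopGroup N} (hf : f ∈ rootSubgroup α)
    (h : ¬ pivot α 0 (f 1) ≠ 0) : pivot α 1 (f 1) ≠ 0 := by
  obtain ⟨A, t, ht, rfl⟩ := exists_of_mem α hf
  have h1 : (rootLoop α A * constLoop N t) 1 = rootLoop α A 1 * t := rfl
  rw [h1, pivot_mul_right α _ _ ht] at h ⊢
  refine mul_ne_zero ?_ (maxTorus_ne_zero ht _)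
  have h0 := (mul_eq_zero.1 (not_not.1 h)).resolve_right (maxTorus_ne_zero ht α.p)
  intro h2
  have hA := SU2_norm A
  simp only [pivot, if_true, one_ne_zero, if_false, rootLoop_one_pp, rootLoop_one_qp] at h0 h2
  rw [h0, h2] at hA
  simp at hA

/-- A family of matrices in `SU(N)` with smooth entries. -/
def SmoothEntries (S : Set (Fin n → ℂ)) (G : (Fin n → ℂ) → SU N) : Prop :=
  ∀ r s, ContDiffOn ℝ ∞ (fun z => (G z).1 r s) S

lemma contDiff_conj : ContDiff ℝ ∞ (fun z : ℂ => conj z) :=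
  Complex.conjCLE.contDiff

lemma SmoothEntries.mul {S : Set (Fin n → ℂ)} {G H : (Fin n → ℂ) → SU N}
    (hG : SmoothEntries S G) (hH : SmoothEntries S H) :
    SmoothEntries S fun z => G z * H z := by
  intro r s
  change ContDiffOn ℝ ∞ (fun z => ((G z).1 * (H z).1) r s) S
  simp only [Matrix.mul_apply]
  exact ContDiffOn.sum fun a _ => (hG r a).mul (hH a s)

lemma SmoothEntries.inv {S : Set (Fin n → ℂ)} {G : (Fin n → ℂ) → SU N}
    (hG : SmoothEntries S G) : SmoothEntries S fun z => (G z)⁻¹ := by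
  intro r s
  change ContDiffOn ℝ ∞ (fun z => conj ((G z).1 s r)) S
  exact contDiff_conj.comp_contDiffOn (hG s r)

lemma contDiff_invNorm : ContDiff ℝ ∞ invNorm := by
  have h : ContDiff ℝ ∞ fun z : ℂ => 1 + Complex.normSq z := by
    have : (fun z : ℂ => 1 + Complex.normSq z) = fun z : ℂ => 1 + (z.re * z.re + z.im * z.im) := by
      funext z; rw [Complex.normSq_apply]
    rw [this]
    exact contDiff_const.add ((Complex.reCLM.contDiff.mul Complex.reCLM.contDiff).add
      (Complex.imCLM.contDiff.mul Complex.imCLM.contDiff))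
  exact Complex.ofRealCLM.contDiff.comp
    ((h.sqrt fun z => (one_add_normSq_pos z).ne').inv
      fun z => (Real.sqrt_pos.2 (one_add_normSq_pos z)).ne')

lemma contDiff_chartSU2 (c : Fin 2) (a b : Fin 2) :
    ContDiff ℝ ∞ fun z => (chartSU2 c z).1 a b := by
  have h := contDiff_invNorm
  have h' := contDiff_conj
  have hI : ContDiff ℝ ∞ fun z => Complex.I * invNorm z := contDiff_const.mul h
  rcases fin2_cases c with rfl | rfl
  · simp only [chartSU2_zero_coe]
    fin_cases a <;> fin_cases b <;> simp
    · exact h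
    · exact (h.mul h').neg
    · exact h.mul contDiff_id
    · exact h
  · simp only [chartSU2_one_coe]
    fin_cases a <;> fin_cases b <;> simp
    · exact hI.mul contDiff_id
    · exact hI
    · exact hI
    · exact (hI.mul h').neg

lemma SmoothEntries.sect {S : Set (Fin n → ℂ)} (α : AffineRoot N) (c : Fin 2)
    {f : (Fin n → ℂ) → ℂ} (hf : ContDiffOn ℝ ∞ f S) :
    SmoothEntries S fun z => BottSamelson.sect α c (f z) := by
  intro r s
  have ha := (contDiff_chartSU2 c 0 0).comp_contDiffOn hf
  have hb := (contDiff_chartSU2 c 1 0).comp_contDiffOn hf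
  change ContDiffOn ℝ ∞ (fun z => rootMatrix α ((chartSU2 c (f z)).1 0 0)
    ((chartSU2 c (f z)).1 1 0) 1 r s) S
  simp only [rootMatrix, Matrix.of_apply]
  split_ifs
  · exact ha
  · exact hb.mul contDiffOn_const
  · exact contDiffOn_const
  · exact (contDiff_conj.comp_contDiffOn hb).neg.mul contDiffOn_const
  · exact contDiff_conj.comp_contDiffOn ha
  all_goals exact contDiffOn_const

lemma SmoothEntries.slope {S : Set (Fin n → ℂ)} (α : AffineRoot N) (c : Fin 2)
    {G : (Fin n → ℂ) → SU N} (hG : SmoothEntries S G) (h : ∀ z ∈ S, pivot α c (G z) ≠ 0) :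
    ContDiffOn ℝ ∞ (fun z => BottSamelson.slope α c (G z)) S := by
  rcases fin2_cases c with rfl | rfl
  · exact (hG _ _).mul ((hG _ _).inv fun z hz => by simpa [pivot] using h z hz)
  · exact (hG _ _).mul ((hG _ _).inv fun z hz => by simpa [pivot] using h z hz)

lemma rotate_const (θ : Circle) (t : SU N) : rotate N θ (constLoop N t) = constLoop N t := rfl

end smooth

section BS

variable {N : ℕ} [N.AtLeastTwo] {n : ℕ} {i : Fin n → Fin N}

/-- A choice, at each place, of an affine chart of the projective line around a point. -/
def chartIndex (m : BSManifold i) : Fin n → Fin 2 := fun j =>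
  open Classical in
  if pivot (simpleRoot (i j)) 0 (evalOne (Quotient.out m) j) ≠ 0 then 0 else 1

lemma mem_affineSource_chartIndex (m : BSManifold i) : m ∈ affineSource (chartIndex m) := by
  have hm : BSManifold.mk i (Quotient.out m) = m := Quotient.out_eq m
  rw [← hm]
  intro j
  rw [hm]
  unfold chartIndex
  split_ifs with h
  · exact h
  · exact pivot_one_of_zero _ (Quotient.out m j).2 h

/-- The atlas of the affine charts. -/
instance instChartedSpaceBS : ChartedSpace (Fin n → ℂ) (BSManifold i) where
  atlas := Set.range (affineChart i)
  chartAt m := affineChart i (chartIndex m)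
  mem_chart_source m := mem_affineSource_chartIndex m
  chart_mem_atlas _ := ⟨_, rfl⟩

lemma contDiffOn_transition (e e' : Fin n → Fin 2) (S : Set (Fin n → ℂ))
    (hS : ∀ z ∈ S, affineTuple i e z ∈ tupleSource i e') :
    ContDiffOn ℝ ∞ (fun z => coords i e' (evalOne (affineTuple i e z))) S := by
  have hg : ∀ j, SmoothEntries S fun z => evalOne (affineTuple i e z) j := fun j =>
    SmoothEntries.sect _ _ (contDiff_apply ℝ ℂ j).contDiffOn
  have hp : ∀ z ∈ S, ∀ j, pivot (simpleRoot (i j)) (e' j)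
      (twist i e' (evalOne (affineTuple i e z)) j.castSucc * evalOne (affineTuple i e z) j) ≠ 0 :=
    fun z hz j => (pivot_mul_left _ _ _ (twist_mem e' _ (hS z hz) _)).2 (hS z hz j)
  have ht : ∀ j, SmoothEntries S fun z => twist i e' (evalOne (affineTuple i e z)) j := by
    intro j
    induction j using Fin.induction with
    | zero => exact fun r s => contDiffOn_const
    | succ j ih =>
      have h1 := ih.mul (hg j)
      simp only [twist_succ]
      exact (SmoothEntries.sect _ _ (h1.slope _ _ fun z hz => hp z hz j)).inv.mul h1
  exact contDiffOn_pi.2 fun j => ((ht _).mul (hg j)).slope _ _ fun z hz => hp z hz j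

/-- `M_w` is a smooth manifold of real dimension `2n`. -/
instance instIsManifoldBS : IsManifold 𝓘(ℝ, Fin n → ℂ) ∞ (BSManifold i) := by
  refine isManifold_of_contDiffOn _ _ _ ?_
  rintro _ _ ⟨e, rfl⟩ ⟨e', rfl⟩
  simp only [modelWithCornersSelf_coe, modelWithCornersSelf_coe_symm, Function.comp_id,
    Function.id_comp, Set.preimage_id, Set.range_id, Set.inter_univ]
  exact contDiffOn_transition e e' _ fun z hz => hz.2

/-- The action of `T × S¹` on tuples: `t` multiplies the first component on the left, `θ` rotates
every component. -/
def actTuple (h : maxTorus N × Circle) (x : BSProd i) : BSProd i := fun j =>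
  ⟨(if (j : ℕ) = 0 then constLoop N h.1 else 1) * rotate N h.2 (x j),
    mul_mem (by split_ifs; exacts [constLoop_mem _ h.1.2, one_mem _]) (rotate_mem _ _ (x j).2)⟩

lemma actTuple_rel (h : maxTorus N × Circle) {x y : BSProd i} (hxy : (bsSetoid i).r x y) :
    (bsSetoid i).r (actTuple h x) (actTuple h y) := by
  obtain ⟨t, h0, ht⟩ := hxy
  refine ⟨t, h0, fun j => ?_⟩
  simp only [actTuple, ht j, map_mul, map_inv, rotate_const]
  split_ifs with hj
  · have : j.castSucc = 0 := Fin.ext hj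
    simp [this, h0, mul_assoc]
  · simp [mul_assoc]

/-- The action of `T × S¹` on `M_w`:
`(t, θ) · [x_1, …, x_n] = [t (θ · x_1), θ · x_2, …, θ · x_n]`. -/
instance instMulActionBS : MulAction (maxTorus N × Circle) (BSManifold i) where
  smul h := Quotient.map (actTuple h) fun _ _ hxy => actTuple_rel h hxy
  one_smul := by
    rintro ⟨x⟩
    refine congrArg (BSManifold.mk i) (funext fun j => Subtype.ext ?_)
    have : rotate N 1 (x j : LoopGroup N) = x j := by
      ext u : 1
      change (x j : LoopGroup N) (u * 1) = _
      rw [mul_one]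
    simp [actTuple, this]
  mul_smul := by
    rintro g h ⟨x⟩
    refine congrArg (BSManifold.mk i) (funext fun j => Subtype.ext ?_)
    have : rotate N (g.2 * h.2) (x j : LoopGroup N) = rotate N g.2 (rotate N h.2 (x j)) := by
      ext u : 1
      change (x j : LoopGroup N) (u * (g.2 * h.2)) = (x j : LoopGroup N) (u * g.2 * h.2)
      rw [mul_assoc]
    simp only [actTuple, Prod.fst_mul, Prod.snd_mul, Subgroup.coe_mul, map_mul, this]
    split_ifs
    · rw [rotate_const, mul_assoc]
    · simp

/-- The lift `exp(F) exp(-E) exp(F) = (1, 0; 1, 1) (1, -1; 0, 1) (1, 0; 1, 1) = (0, -1; 1, 0)` of the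
nontrivial Weyl group element of `SU(2)`. -/
def weylLift : SU 2 := mkSU2 0 1 (by simp)

lemma weylLift_coe :
    weylLift.1 = !![1, 0; 1, 1] * !![1, -1; 0, 1] * !![1, 0; 1, 1] := by
  ext a b
  fin_cases a <;> fin_cases b <;> simp [weylLift, mkSU2, Matrix.mul_apply, Fin.sum_univ_two]

variable (i) in
/-- The fixed point `[k_1, …, k_n]` indexed by `e`, where `k_j = 1` if `e_j = 0` and `k_j` is the
lift of `s_{i_j}` if `e_j = 1`. -/
def fixedPt (e : Fin n → Fin 2) : BSManifold i :=
  BSManifold.mk i fun j =>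
    ⟨rootLoop (simpleRoot (i j)) (weylLift ^ (e j : ℕ)), rootLoop_mem _ _⟩

lemma fixedPt_mem (e : Fin n → Fin 2) : fixedPt i e ∈ affineSource e := by
  intro j
  change pivot _ _ (rootLoop (simpleRoot (i j)) (weylLift ^ (e j : ℕ)) 1) ≠ 0
  rcases fin2_cases (e j) with h | h <;>
    simp [h, pivot, rootLoop_one_pp, rootLoop_one_qp, weylLift, mkSU2, -map_pow, -map_one]

/-- The differential at the fixed point `e` of the affine coordinates around it. -/
def tangentCoord (e : Fin n → Fin 2) :
    TangentSpace 𝓘(ℝ, Fin n → ℂ) (fixedPt i e) ≃L[ℝ] (Fin n → ℂ) :=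
  haveI : IsManifold 𝓘(ℝ, Fin n → ℂ) 1 (BSManifold i) := IsManifold.of_le (n := ∞) (by simp)
  (mdifferentiable_of_mem_atlas (I := 𝓘(ℝ, Fin n → ℂ)) (e := affineChart i e)
    (show affineChart i e ∈ Set.range (affineChart i) from ⟨e, rfl⟩)).mfderiv (fixedPt_mem e)

lemma tangentCoord_coe (e : Fin n → Fin 2)
    (v : TangentSpace 𝓘(ℝ, Fin n → ℂ) (fixedPt i e)) :
    tangentCoord e v =
      mfderiv 𝓘(ℝ, Fin n → ℂ) 𝓘(ℝ, Fin n → ℂ) (affineChart i e) (fixedPt i e) v := rfl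

/-- The complex structure on the tangent space at the fixed point `e`, given by the complex affine
coordinates `(z_1, …, z_n)` around that point. -/
instance instModuleTangent (e : Fin n → Fin 2) :
    Module ℂ (TangentSpace 𝓘(ℝ, Fin n → ℂ) (fixedPt i e)) :=
  (tangentCoord e).toLinearEquiv.toAddEquiv.module ℂ

end BS

section weights

/-- The Lie algebra of the torus `T`: the diagonal matrices `diag(i X_1, …, i X_N)` of trace zero,
recorded by the real tuple `X`. -/
def cartan (N : ℕ) : Submodule ℝ (Fin N → ℝ) where
  carrier := {X | ∑ a, X a = 0}
  add_mem' := by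
    intro X Y hX hY
    change ∑ a, (X a + Y a) = 0
    rw [Finset.sum_add_distrib, show ∑ a, X a = 0 from hX, show ∑ a, Y a = 0 from hY, add_zero]
  zero_mem' := by simp
  smul_mem' := by
    intro c X hX
    change ∑ a, c * X a = 0
    rw [← Finset.mul_sum, show ∑ a, X a = 0 from hX, mul_zero]

/-- The dual of the Lie algebra of `T × S¹`, in which the weights live. -/
abbrev Weight (N : ℕ) : Type := Module.Dual ℝ (cartan N × ℝ)

/-- The exponential map of `T × S¹`: `(X, y) ↦ (diag(e^{i X_1}, …, e^{i X_N}), e^{i y})`. -/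
def torusExp {N : ℕ} (X : cartan N × ℝ) : maxTorus N × Circle :=
  (⟨⟨Matrix.diagonal fun a => (Circle.exp (X.1.1 a) : ℂ), by
      rw [Matrix.mem_specialUnitaryGroup_iff]
      refine ⟨Matrix.mem_unitaryGroup_iff.2 ?_, ?_⟩
      · rw [Matrix.star_eq_conjTranspose, Matrix.diagonal_conjTranspose,
          Matrix.diagonal_mul_diagonal, ← Matrix.diagonal_one]
        congr 1
        funext a
        change (Circle.exp (X.1.1 a) : ℂ) * conj (Circle.exp (X.1.1 a) : ℂ) = 1
        rw [Complex.mul_conj, Circle.normSq_coe, Complex.ofReal_one]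
      · have h : ∑ a, X.1.1 a = 0 := X.1.2
        simp only [Matrix.det_diagonal, Circle.coe_exp]
        rw [← Complex.exp_sum, ← Finset.sum_mul, ← Complex.ofReal_sum, h]
        simp⟩,
    Matrix.isDiag_diagonal _⟩, Circle.exp X.2)

/-- The affine root `(e_p - e_q, k)` as a weight of `T × S¹`. -/
def AffineRoot.weight {N : ℕ} (α : AffineRoot N) : Weight N where
  toFun X := X.1.1 α.p - X.1.1 α.q + α.k * X.2
  map_add' X Y := by simp; ring
  map_smul' c X := by simp; ring

/-- The coroot `(e_p - e_q, 0)` in the Lie algebra of `T × S¹`. -/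
def AffineRoot.coroot {N : ℕ} (α : AffineRoot N) : cartan N × ℝ :=
  (⟨Pi.single α.p 1 - Pi.single α.q 1, by
    change ∑ a, (Pi.single α.p (1 : ℝ) - Pi.single α.q 1 : Fin N → ℝ) a = 0
    simp⟩, 0)

/-- The affine reflection `λ ↦ λ - ⟨λ, α^∨⟩ α` on the weights of `T × S¹`. -/
def AffineRoot.reflection {N : ℕ} (α : AffineRoot N) : Module.End ℝ (Weight N) :=
  LinearMap.id - (Module.Dual.eval ℝ (cartan N × ℝ) α.coroot).smulRight α.weight

lemma AffineRoot.reflection_apply {N : ℕ} (α : AffineRoot N) (β : Weight N) :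
    α.reflection β = β - β α.coroot • α.weight := rfl

/-- The product `s_{i_1}^{e_1} ⋯ s_{i_j}^{e_j}` in the affine Weyl group, acting on the weights. -/
def galleryPrefix {N : ℕ} [N.AtLeastTwo] {n : ℕ} (i : Fin n → Fin N) (e : Fin n → Fin 2)
    (j : Fin n) : Module.End ℝ (Weight N) :=
  (List.ofFn fun m : Fin ((j : ℕ) + 1) =>
    (simpleRoot (i (Fin.castLE j.isLt m))).reflection ^ (e (Fin.castLE j.isLt m) : ℕ)).prod

/-- The complex representation `V` of `T × S¹` is the direct sum of complex lines on which the torus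
acts by the weights `β_j`, where `exp(X)` acts by `e^{i β(X)}` on a line of weight `β`. -/
def HasWeights {N : ℕ} {ι V : Type*} [AddCommGroup V] [Module ℂ V]
    (ρ : Representation ℂ (maxTorus N × Circle) V) (β : ι → Weight N) : Prop :=
  ∃ b : Module.Basis ι ℂ V, ∀ (X : cartan N × ℝ) (j : ι),
    ρ (torusExp X) (b j) = Complex.exp (Complex.I * (β j X : ℂ)) • b j

/-- The polynomial function on the Lie algebra of `T × S¹` given by an element of the symmetric
algebra of its dual. -/
def evalSym {N : ℕ} (X : cartan N × ℝ) : SymmetricAlgebra ℝ (Weight N) →ₐ[ℝ] ℝ :=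
  SymmetricAlgebra.lift (Module.Dual.eval ℝ (cartan N × ℝ) X)

/-- `ε` is the equivariant Euler class of the finite-dimensional complex representation `V` of
`T × S¹`, regarded as an equivariant vector bundle over a point. The equivariant cohomology of the
point is the symmetric algebra of the dual of the Lie algebra, that is, the algebra of polynomial
functions on the Lie algebra; by equivariant Chern-Weil theory the Euler class (the top Chern class)
is the polynomial function `X ↦ det_ℂ(-i dρ(X))`, where `dρ` is the infinitesimal action. -/
def IsEquivariantEulerClass {N : ℕ} {V : Type*} [AddCommGroup V] [Module ℂ V] [TopologicalSpace V]
    (ρ : Representation ℂ (maxTorus N × Circle) V) (ε : SymmetricAlgebra ℝ (Weight N)) : Prop :=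
  ∀ X : cartan N × ℝ, ∃ A : V →ₗ[ℂ] V,
    (∀ v, Filter.Tendsto (fun s : ℝ => (s : ℂ)⁻¹ • (ρ (torusExp (s • X)) v - v))
      (nhdsWithin 0 {0}ᶜ) (nhds (A v))) ∧
    ((evalSym X ε : ℝ) : ℂ) = LinearMap.det (-Complex.I • A)

end weights

/-- `ρ` is the isotropy representation of `T × S¹` on the tangent space of `M_w` at the fixed point
`e`: the differential of the action. -/
def IsIsotropyRepresentation {N : ℕ} [N.AtLeastTwo] {n : ℕ} (i : Fin n → Fin N) (e : Fin n → Fin 2)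
    (ρ : Representation ℂ (maxTorus N × Circle)
      (TangentSpace 𝓘(ℝ, Fin n → ℂ) (fixedPt i e))) : Prop :=
  ∀ h : maxTorus N × Circle,
    MDifferentiableAt 𝓘(ℝ, Fin n → ℂ) 𝓘(ℝ, Fin n → ℂ)
      (fun m : BSManifold i => h • m) (fixedPt i e) ∧
    ∀ v, ρ h v = mfderiv 𝓘(ℝ, Fin n → ℂ) 𝓘(ℝ, Fin n → ℂ)
      (fun m : BSManifold i => h • m) (fixedPt i e) v

end BottSamelson

end

open BottSamelson

/-! A torus element can be pushed from left to right through a factor `Ψ_α(m_z)`. Put `X' = X` on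
the chart around `1` and `X' = X - α(X) α^∨` on the chart around the Weyl element. If the loop is
rotated by the circle component of `exp X`, then the `T`-component of `exp X` times the rotated
`Ψ_α(m_z)` equals `Ψ_α(m_{χz})` times the `T`-component of `exp X'`, with `χ = e^{-iα(X')}`
(`torusExp_mul_rootLoop`). On the first chart the coordinate `b/a` has weight `-α`; on the second,
`a/b` has weight `α`, the reflection of `-α`, so one formula covers both.

Coroots have no circle component, so `X'` keeps the rotation parameter of `X`, and the next factor,
rotated by the same angle, is passed in the same way. The torus element left after the last factor
is absorbed by the quotient by `T^n`. Hence the action is diagonal in the whole chart `Φ_e`, not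
only to first order (`torusExp_smul_affine`): `z_j` is multiplied by `e^{iβ}`, where `β` is the
value of `-α_{i_j}` on the vector obtained from `X` by the first `j` reflections. Transposing these
reflections reverses their order and turns `β` into the value at `X` of the prefix of the word
applied to `-α_{i_j}` (`galleryPrefix_apply`).

The rest is linear algebra. Diagonal maps fix the origin `k_e` and preserve the chart domain; by the
chain rule the differential at `k_e` is the same diagonal map, which is complex linear, and the
coordinate vectors span the weight lines (`tangentCoord_mfderiv_smul`). Multiplying the
infinitesimal action by `-i` gives the eigenvalues `β_j(X)`, whose product is the Euler class. Since
`exp` is onto (`torusExp_surjective`), formulas on `exp X` hold on the whole group. -/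

namespace BottSamelson

/-! ### Commuting the torus past a single root subgroup -/

section torus

variable {N : ℕ}

/-- The affine reflection `X ↦ X - α(X) α^∨` on the Lie algebra of `T × S¹`, whose transpose is
`AffineRoot.reflection`. -/
noncomputable def AffineRoot.coreflection (α : AffineRoot N) : Module.End ℝ (cartan N × ℝ) :=
  LinearMap.id - α.weight.smulRight α.coroot

lemma AffineRoot.coreflection_apply (α : AffineRoot N) (X : cartan N × ℝ) :
    α.coreflection X = X - α.weight X • α.coroot := rfl

lemma AffineRoot.weight_apply (α : AffineRoot N) (X : cartan N × ℝ) :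
    α.weight X = X.1.1 α.p - X.1.1 α.q + α.k * X.2 := rfl

/-- Both sides of the nontrivial case equal `β(X) - β(α^∨) α(X)`: the reflections on weights and on
the Lie algebra are transposes of each other. -/
lemma AffineRoot.reflection_pow_apply (α : AffineRoot N) (c : Fin 2) (β : Weight N)
    (X : cartan N × ℝ) :
    (α.reflection ^ (c : ℕ)) β X = β ((α.coreflection ^ (c : ℕ)) X) := by
  rcases fin2_cases c with rfl | rfl
  · simp
  · simp [reflection_apply, coreflection_apply, mul_comm]

/-- The coroot has zero circle component. Hence a single rotation angle serves all factors of the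
word. -/
lemma AffineRoot.coreflection_pow_snd (α : AffineRoot N) (c : Fin 2) (X : cartan N × ℝ) :
    ((α.coreflection ^ (c : ℕ)) X).2 = X.2 := by
  rcases fin2_cases c with rfl | rfl
  · simp
  · simp [coreflection_apply, coroot]

lemma AffineRoot.coreflection_fst (α : AffineRoot N) (X : cartan N × ℝ) (a : Fin N) :
    (α.coreflection X).1.1 a = X.1.1 a -
      α.weight X * ((Pi.single α.p 1 - Pi.single α.q 1 : Fin N → ℝ) a) := by
  simp [coreflection_apply, coroot]

lemma torusExp_fst_apply (X : cartan N × ℝ) (a : Fin N) :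
    (torusExp X).1.1.1 a a = (Circle.exp (X.1.1 a) : ℂ) := by
  simp [torusExp]

/-- The normalisation depends only on `|z|`, so multiplying the coordinate by a character does not
affect it. -/
lemma invNorm_mul_circle (z : ℂ) (c : Circle) : invNorm (c * z) = invNorm z := by
  simp [invNorm]

/-- Passing a torus element through `Ψ_α`, on matrix entries. -/
lemma const_mul_rotate_rootLoop (α : AffineRoot N) {t t' : SU N} (ht : t ∈ maxTorus N)
    (ht' : t' ∈ maxTorus N) (θ : Circle) (A B : SU 2)
    (hpp : t.1 α.p α.p * A.1 0 0 = B.1 0 0 * t'.1 α.p α.p)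
    (hqp : t.1 α.q α.q * (A.1 1 0 * (θ : ℂ) ^ (-α.k)) = B.1 1 0 * t'.1 α.p α.p)
    (hpq : t.1 α.p α.p * (conj (A.1 1 0) * (θ : ℂ) ^ α.k) = conj (B.1 1 0) * t'.1 α.q α.q)
    (hqq : t.1 α.q α.q * conj (A.1 0 0) = conj (B.1 0 0) * t'.1 α.q α.q)
    (hr : ∀ r, r ≠ α.p → r ≠ α.q → t.1 r r = t'.1 r r) :
    constLoop N t * rotate N θ (rootLoop α A) = rootLoop α B * constLoop N t' := by
  have hn := α.ne
  ext u r s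
  change (t.1 * rootMatrix α (A.1 0 0) (A.1 1 0) (u * θ)) r s =
    (rootMatrix α (B.1 0 0) (B.1 1 0) u * t'.1) r s
  rw [maxTorus_mul_left ht, maxTorus_mul_right ht']
  simp only [rootMatrix, Matrix.of_apply, Circle.coe_mul, mul_zpow]
  by_cases hs : s = α.p
  · subst hs
    by_cases h1 : r = α.p
    · subst h1; simpa using hpp
    · by_cases h2 : r = α.q
      · subst h2
        simp only [if_true, if_neg h1]
        -- The hypotheses are the entry identities at `u = 1`; a general `u` contributes the same
        -- power of `u` to both sides of an off-diagonal entry.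
        linear_combination (u : ℂ) ^ (-α.k) * hqp
      · simp [h1, h2]
  · by_cases hs2 : s = α.q
    · subst hs2
      by_cases h1 : r = α.p
      · subst h1
        simp only [if_true, if_neg hs]
        linear_combination -(u : ℂ) ^ α.k * hpq
      · by_cases h2 : r = α.q
        · subst h2; simpa [hs] using hqq
        · simp [h1, h2, hs]
    · by_cases h : r = s
      · subst h; simp [hs, hs2, hr r hs hs2]
      · simp [hs, hs2, h]

/-- Passing `exp X` through `Ψ_α(m_z)` reflects `X` on the chart around the Weyl element, and
multiplies the coordinate by a character. -/
lemma torusExp_mul_rootLoop (α : AffineRoot N) (c : Fin 2) (X : cartan N × ℝ) (z : ℂ) :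
    constLoop N (torusExp X).1 * rotate N (Circle.exp X.2) (rootLoop α (chartSU2 c z)) =
      rootLoop α (chartSU2 c
        ((Circle.exp (-α.weight ((α.coreflection ^ (c : ℕ)) X)) : ℂ) * z)) *
      constLoop N (torusExp ((α.coreflection ^ (c : ℕ)) X)).1 := by
  have hn := α.ne
  have hc : ∀ x : Circle, conj (x : ℂ) = (x : ℂ)⁻¹ := fun x => by
    rw [← Circle.coe_inv_eq_conj, Circle.coe_inv]
  have hz : ∀ (x : Circle), (x : ℂ) ≠ 0 := Circle.coe_ne_zero
  rcases fin2_cases c with rfl | rfl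
  · have hw : Circle.exp (-α.weight X) =
        (Circle.exp (X.1.1 α.p))⁻¹ * Circle.exp (X.1.1 α.q) * Circle.exp X.2 ^ (-α.k) := by
      rw [← Circle.exp_neg, ← Circle.exp_zsmul, ← Circle.exp_add, ← Circle.exp_add, α.weight_apply]
      congr 1
      simp
      ring
    simp only [Fin.val_zero, pow_zero, Module.End.one_apply]
    apply const_mul_rotate_rootLoop α (torusExp X).1.2 (torusExp X).1.2
    all_goals simp only [torusExp_fst_apply, hw, chartSU2_zero_coe, invNorm_mul_circle]
    case hr => simp
    -- Four entry identities remain; they are algebraic identities in the unit numbers `P`, `Q`,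
    -- `Θ`, whose conjugates are their inverses.
    all_goals
      generalize Circle.exp (X.1.1 α.p) = P
      generalize Circle.exp (X.1.1 α.q) = Q
      generalize Circle.exp X.2 = Θ
      simp [hc, invNorm_conj]
      try field_simp [hz]
  -- Since `α(α^∨) = 2`, the reflected vector has `-α(X') = α(X)`.
  · have hw : Circle.exp (-α.weight (α.coreflection X)) =
        Circle.exp (X.1.1 α.p) * (Circle.exp (X.1.1 α.q))⁻¹ * Circle.exp X.2 ^ α.k := by
      rw [← Circle.exp_neg, ← Circle.exp_zsmul, ← Circle.exp_add, ← Circle.exp_add, α.weight_apply,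
        α.coreflection_fst, α.coreflection_fst, α.weight_apply]
      congr 1
      simp [AffineRoot.coreflection_apply, AffineRoot.coroot, hn, hn.symm]
      ring
    -- The reflection exchanges the coordinates `p` and `q` up to a shift by the rotation parameter
    -- `y`: `X_p - α(X) = X_q - k y` and `X_q + α(X) = X_p + k y`.
    have hp : Circle.exp ((α.coreflection X).1.1 α.p) =
        Circle.exp (X.1.1 α.q) * Circle.exp X.2 ^ (-α.k) := by
      rw [← Circle.exp_zsmul, ← Circle.exp_add, α.coreflection_fst, α.weight_apply]
      congr 1
      simp [hn]
      ring
    have hq : Circle.exp ((α.coreflection X).1.1 α.q) =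
        Circle.exp (X.1.1 α.p) * Circle.exp X.2 ^ α.k := by
      rw [← Circle.exp_zsmul, ← Circle.exp_add, α.coreflection_fst, α.weight_apply]
      congr 1
      simp [hn.symm]
      ring
    simp only [Fin.val_one, pow_one]
    apply const_mul_rotate_rootLoop α (torusExp X).1.2 (torusExp (α.coreflection X)).1.2
    all_goals simp only [torusExp_fst_apply, hw, hp, hq, chartSU2_one_coe, invNorm_mul_circle]
    case hr =>
      intro r hrp hrq
      simp [α.coreflection_fst, hrp, hrq]
    all_goals
      generalize Circle.exp (X.1.1 α.p) = P
      generalize Circle.exp (X.1.1 α.q) = Q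
      generalize Circle.exp X.2 = Θ
      simp [hc, invNorm_conj]
      try field_simp [hz]

/-- `T × S¹` is connected: its exponential map is onto. -/
lemma torusExp_surjective [NeZero N] : Function.Surjective (torusExp (N := N)) := by
  rintro ⟨⟨t, ht⟩, θ⟩
  have hdiag : Matrix.diagonal (fun a => t.1 a a) = t.1 :=
    (Matrix.isDiag_iff_diagonal_diag _).1 ht
  have hex : ∀ a, ∃ x : ℝ, (Circle.exp x : ℂ) = t.1 a a := by
    intro a
    have h1 : ‖t.1 a a‖ = 1 := by
      have := maxTorus_conj ht a
      rw [Complex.mul_conj, Complex.normSq_eq_norm_sq] at this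
      have h2 : ‖t.1 a a‖ ^ 2 = 1 := by exact_mod_cast this
      exact (pow_eq_one_iff_of_nonneg (norm_nonneg _) two_ne_zero).1 h2
    refine ⟨Complex.arg (t.1 a a), ?_⟩
    rw [Circle.coe_exp]
    simpa [h1] using Complex.norm_mul_exp_arg_mul_I (t.1 a a)
  choose x hx using hex
  have hdet : Circle.exp (∑ a, x a) = 1 := by
    have h := t.2.2
    have h' : t.1.det = 1 := h
    rw [← hdiag, Matrix.det_diagonal] at h'
    apply Circle.coe_injective
    rw [Circle.coe_exp, Complex.ofReal_sum, Finset.sum_mul, Complex.exp_sum]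
    simpa [← hx] using h'
  -- The arguments `x` of the diagonal entries need not sum to zero, but determinant one puts their
  -- sum in `2πℤ`. Subtracting it from one coordinate gives trace zero without changing the
  -- exponential.
  let Y : Fin N → ℝ := x - Pi.single 0 (∑ a, x a)
  have hY : Y ∈ cartan N := by
    change ∑ a, (x a - (Pi.single 0 (∑ b, x b) : Fin N → ℝ) a) = 0
    simp
  refine ⟨(⟨Y, hY⟩, Complex.arg θ), Prod.ext (Subtype.ext (Subtype.ext ?_)) (Circle.exp_arg θ)⟩
  change Matrix.diagonal (fun a => (Circle.exp (Y a) : ℂ)) = t.1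
  rw [← hdiag]
  congr 1
  funext a
  rw [← hx a]
  congr 1
  by_cases h : a = 0
  · subst h
    simp [Y, Circle.exp_sub, hdet]
    rfl
  · simp [Y, h]
    rfl

end torus

/-! ### The action of the torus on the affine charts -/

section action

variable {N : ℕ} [N.AtLeastTwo] {n : ℕ} {i : Fin n → Fin N}

variable (i) in
/-- The images of `X` under the successive affine reflections along the word. -/
noncomputable def reflected (e : Fin n → Fin 2) (X : cartan N × ℝ) : Fin (n + 1) → cartan N × ℝ :=
  Fin.induction (motive := fun _ => cartan N × ℝ) X
    (fun j Y => ((simpleRoot (i j)).coreflection ^ (e j : ℕ)) Y)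

lemma reflected_zero (e : Fin n → Fin 2) (X : cartan N × ℝ) : reflected i e X 0 = X := rfl

lemma reflected_succ (e : Fin n → Fin 2) (X : cartan N × ℝ) (j : Fin n) :
    reflected i e X j.succ =
      ((simpleRoot (i j)).coreflection ^ (e j : ℕ)) (reflected i e X j.castSucc) := by
  simp [reflected]

lemma reflected_snd (e : Fin n → Fin 2) (X : cartan N × ℝ) (j : Fin (n + 1)) :
    (reflected i e X j).2 = X.2 := by
  induction j using Fin.induction with
  | zero => rfl
  | succ j ih => rw [reflected_succ, AffineRoot.coreflection_pow_snd, ih]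

/-- Transposing a product reverses its order: the leftmost reflection of the word acts first on `X`,
exactly as in `reflected`. -/
lemma prod_reflection_apply (e : Fin n → Fin 2) (X : cartan N × ℝ) (m : ℕ) (hm : m ≤ n)
    (β : Weight N) :
    (List.ofFn fun l : Fin m => (simpleRoot (i (Fin.castLE hm l))).reflection ^
      (e (Fin.castLE hm l) : ℕ)).prod β X = β (reflected i e X ⟨m, Nat.lt_succ_of_le hm⟩) := by
  induction m generalizing β with
  | zero => simp; rfl
  | succ m ih =>
    -- The last factor is split off and absorbed into the weight, so the induction hypothesis is
    -- needed for every `β`.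
    rw [List.ofFn_succ', List.concat_eq_append, List.prod_append, List.prod_singleton,
      Module.End.mul_apply]
    refine (ih (Nat.le_of_succ_le hm) _).trans ?_
    rw [AffineRoot.reflection_pow_apply]
    exact congrArg β (reflected_succ e X ⟨m, hm⟩).symm

lemma galleryPrefix_apply (e : Fin n → Fin 2) (j : Fin n) (β : Weight N) (X : cartan N × ℝ) :
    galleryPrefix i e j β X = β (reflected i e X j.succ) :=
  prod_reflection_apply e X (j + 1) j.isLt β

/-- In the affine coordinates around the fixed point `e`, the torus acts diagonally. -/
lemma torusExp_smul_affine (e : Fin n → Fin 2) (X : cartan N × ℝ) (z : Fin n → ℂ) :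
    torusExp X • BSManifold.mk i (affineTuple i e z) =
      BSManifold.mk i (affineTuple i e fun j =>
        (Circle.exp (galleryPrefix i e j (-(simpleRoot (i j)).weight) X) : ℂ) * z j) := by
  refine Quotient.sound (s := bsSetoid i)
    -- These `t_j` carry the torus element emerging from one factor into the next. The entry at `0`
    -- must be `1`: the factor `exp X` in front of the first component is supplied by the action
    -- itself.
    ⟨fun j => if j = 0 then 1 else (torusExp (reflected i e X j)).1⁻¹, if_pos rfl, fun j => ?_⟩
  have key := torusExp_mul_rootLoop (simpleRoot (i j)) (e j) (reflected i e X j.castSucc) (z j)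
  rw [← reflected_succ, reflected_snd] at key
  have hx : (actTuple (torusExp X) (affineTuple i e z) j : LoopGroup N) =
      (if (j : ℕ) = 0 then constLoop N (torusExp X).1 else 1) *
        rotate N (Circle.exp X.2) (rootLoop (simpleRoot (i j)) (chartSU2 (e j) (z j))) := rfl
  have hy : (affineTuple i e (fun j =>
        (Circle.exp (galleryPrefix i e j (-(simpleRoot (i j)).weight) X) : ℂ) * z j) j :
        LoopGroup N) =
      rootLoop (simpleRoot (i j)) (chartSU2 (e j)
        ((Circle.exp (-(simpleRoot (i j)).weight (reflected i e X j.succ)) : ℂ) * z j)) := by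
    simp only [affineTuple, galleryPrefix_apply, LinearMap.neg_apply]
  rw [hx, hy, eq_mul_inv_of_mul_eq key.symm]
  have hs : j.succ ≠ 0 := Fin.succ_ne_zero j
  by_cases hj : (j : ℕ) = 0
  · have h0 : j.castSucc = 0 := Fin.ext hj
    simp [h0, hj, reflected_zero]
  · have h0 : j.castSucc ≠ 0 := fun h => hj (congrArg Fin.val h)
    simp [h0, hj, mul_assoc]

/-- The numerator of each coordinate vanishes: `b = 0` for the identity and `a = 0` for the Weyl
lift. The torus elements split off earlier only rescale rows. -/
lemma affineCoord_fixedPt (e : Fin n → Fin 2) : affineCoord e (fixedPt i e) = 0 := by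
  funext j
  have ht := twist_mem e _ (fixedPt_mem (i := i) e) j.castSucc
  set x : BSProd i := fun j =>
    ⟨rootLoop (simpleRoot (i j)) (weylLift ^ (e j : ℕ)), rootLoop_mem _ _⟩ with hx
  change slope _ _ (twist i e (evalOne x) j.castSucc *
    rootLoop (simpleRoot (i j)) (weylLift ^ (e j : ℕ)) 1) = 0
  rcases fin2_cases (e j) with h | h <;>
    simp [h, slope, maxTorus_mul_left ht, rootLoop_one_pp, rootLoop_one_qp, weylLift, mkSU2,
      -map_pow, -map_one]

/-- This is an equality of classes, not of tuples: `m_0` on the chart around the Weyl element is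
`weylLift` times `diag(i, -i)`. -/
lemma fixedPt_eq (e : Fin n → Fin 2) :
    fixedPt i e = BSManifold.mk i (affineTuple i e 0) := by
  have h := (affineChart i e).left_inv (fixedPt_mem e)
  rw [← h]
  exact congrArg (fun z => BSManifold.mk i (affineTuple i e z)) (affineCoord_fixedPt e)

lemma smul_fixedPt (e : Fin n → Fin 2) (h : maxTorus N × Circle) :
    h • fixedPt i e = fixedPt i e := by
  obtain ⟨X, rfl⟩ := torusExp_surjective h
  rw [fixedPt_eq, torusExp_smul_affine]
  simp only [Pi.zero_apply, mul_zero]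
  rfl

end action

/-! ### The differential at the fixed point, its weights and its Euler class -/

section isotropy

variable {N : ℕ} [N.AtLeastTwo] {n : ℕ} {i : Fin n → Fin N}

lemma affineCoord_affineTuple (e : Fin n → Fin 2) (z : Fin n → ℂ) :
    affineCoord e (BSManifold.mk i (affineTuple i e z)) = z :=
  coords_affineTuple e z

lemma affineTuple_affineCoord (e : Fin n → Fin 2) {m : BSManifold i} (hm : m ∈ affineSource e) :
    BSManifold.mk i (affineTuple i e (affineCoord e m)) = m :=
  (affineChart i e).left_inv hm

lemma affineCoord_torusExp_smul (e : Fin n → Fin 2) (X : cartan N × ℝ) :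
    affineCoord e (torusExp X • BSManifold.mk i (affineTuple i e 1)) =
      fun j => (Circle.exp (galleryPrefix i e j (-(simpleRoot (i j)).weight) X) : ℂ) := by
  rw [torusExp_smul_affine, affineCoord_affineTuple]
  simp

/-- The diagonal multiplier of `h` is read off from the image of the point with coordinates `(1, …,
1)`. It is thus defined without a choice of logarithm of `h`, which makes it a homomorphism in `h`.
-/
lemma smul_affineTuple (e : Fin n → Fin 2) (h : maxTorus N × Circle) (z : Fin n → ℂ) :
    h • BSManifold.mk i (affineTuple i e z) = BSManifold.mk i (affineTuple i e
      (affineCoord e (h • BSManifold.mk i (affineTuple i e 1)) * z)) := by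
  obtain ⟨X, rfl⟩ := torusExp_surjective h
  rw [affineCoord_torusExp_smul, torusExp_smul_affine]
  rfl

variable (i) in
/-- The characters by which `T × S¹` acts on the affine coordinates around the fixed point `e`. -/
noncomputable def coordChar (e : Fin n → Fin 2) : maxTorus N × Circle →* (Fin n → ℂ) where
  toFun h := affineCoord e (h • BSManifold.mk i (affineTuple i e 1))
  map_one' := by rw [one_smul, affineCoord_affineTuple]
  map_mul' g h := by
    rw [mul_smul, smul_affineTuple e h, mul_one, smul_affineTuple e g, affineCoord_affineTuple,
      affineCoord_affineTuple]

lemma coordChar_torusExp (e : Fin n → Fin 2) (X : cartan N × ℝ) (j : Fin n) :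
    coordChar i e (torusExp X) j =
      Complex.exp (Complex.I * (galleryPrefix i e j (-(simpleRoot (i j)).weight) X : ℂ)) := by
  refine (congrFun (affineCoord_torusExp_smul e X) j).trans ?_
  rw [Circle.coe_exp, mul_comm]

lemma smul_mem_affineSource (e : Fin n → Fin 2) (h : maxTorus N × Circle) {m : BSManifold i}
    (hm : m ∈ affineSource e) : h • m ∈ affineSource e := by
  rw [← affineTuple_affineCoord e hm, smul_affineTuple]
  exact (affineChart i e).map_target (Set.mem_univ _)

lemma affineCoord_smul (e : Fin n → Fin 2) (h : maxTorus N × Circle) {m : BSManifold i}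
    (hm : m ∈ affineSource e) : affineCoord e (h • m) = coordChar i e h * affineCoord e m := by
  conv_lhs => rw [← affineTuple_affineCoord e hm, smul_affineTuple, affineCoord_affineTuple]
  rfl

instance : IsManifold 𝓘(ℝ, Fin n → ℂ) 1 (BSManifold i) := IsManifold.of_le (n := ∞) (by simp)

lemma affineChart_mdifferentiable (e : Fin n → Fin 2) :
    (affineChart i e).MDifferentiable 𝓘(ℝ, Fin n → ℂ) 𝓘(ℝ, Fin n → ℂ) :=
  mdifferentiable_of_mem_atlas (show affineChart i e ∈ Set.range (affineChart i) from ⟨e, rfl⟩)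

/-- The linear map by which the group element `h` acts on the affine coordinates. -/
noncomputable def coordCLM (e : Fin n → Fin 2) (h : maxTorus N × Circle) :
    (Fin n → ℂ) →L[ℝ] (Fin n → ℂ) :=
  ContinuousLinearMap.mul ℝ (Fin n → ℂ) (coordChar i e h)

/-- The chart domain is open and invariant, so near the fixed point the action is a linear map
conjugated by the chart. Its differentiability follows. -/
lemma smul_eventuallyEq (e : Fin n → Fin 2) (h : maxTorus N × Circle) :
    (fun m : BSManifold i => h • m) =ᶠ[nhds (fixedPt i e)]
      (affineChart i e).symm ∘ coordCLM (i := i) e h ∘ affineChart i e := by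
  filter_upwards [(isOpen_affineSource e).mem_nhds (fixedPt_mem e)] with m hm
  have := affineTuple_affineCoord e (smul_mem_affineSource e h hm)
  rw [affineCoord_smul e h hm] at this
  exact this.symm

lemma mdifferentiableAt_smul (e : Fin n → Fin 2) (h : maxTorus N × Circle) :
    MDifferentiableAt 𝓘(ℝ, Fin n → ℂ) 𝓘(ℝ, Fin n → ℂ)
      (fun m : BSManifold i => h • m) (fixedPt i e) := by
  have hc := (affineChart_mdifferentiable (i := i) e).mdifferentiableAt (fixedPt_mem e)
  have hs := (affineChart_mdifferentiable (i := i) e).mdifferentiableAt_symm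
    (x := coordCLM (i := i) e h (affineChart i e (fixedPt i e))) (Set.mem_univ _)
  have hl := (coordCLM (i := i) e h).mdifferentiableAt (x := affineChart i e (fixedPt i e))
  exact (hs.comp (fixedPt i e) (hl.comp (fixedPt i e) hc)).congr_of_eventuallyEq
    (smul_eventuallyEq e h)

/-- In the affine coordinates, the differential of the action is diagonal. -/
lemma tangentCoord_mfderiv_smul (e : Fin n → Fin 2) (h : maxTorus N × Circle)
    (v : TangentSpace 𝓘(ℝ, Fin n → ℂ) (fixedPt i e)) :
    tangentCoord (i := i) e (mfderiv 𝓘(ℝ, Fin n → ℂ) 𝓘(ℝ, Fin n → ℂ)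
      (fun m : BSManifold i => h • m) (fixedPt i e) v) = coordChar i e h * tangentCoord e v := by
  have hc := (affineChart_mdifferentiable (i := i) e).mdifferentiableAt (fixedPt_mem e)
  have hl := (coordCLM (i := i) e h).mdifferentiableAt (x := affineChart i e (fixedPt i e))
  -- The identity "chart after `h` equals diagonal map after chart" is differentiated by the chain
  -- rule on both sides.
  have h1 := mfderiv_comp_of_eq (x := fixedPt i e) hc (mdifferentiableAt_smul e h)
    (smul_fixedPt e h)
  have h2 := mfderiv_comp (fixedPt i e) hl hc
  have h3 : (affineChart i e ∘ fun m : BSManifold i => h • m) =ᶠ[nhds (fixedPt i e)]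
      coordCLM (i := i) e h ∘ affineChart i e := by
    filter_upwards [(isOpen_affineSource e).mem_nhds (fixedPt_mem e)] with m hm
    exact affineCoord_smul e h hm
  have h4 := h3.mfderiv_eq (I := 𝓘(ℝ, Fin n → ℂ)) (I' := 𝓘(ℝ, Fin n → ℂ))
  rw [h2, (coordCLM (i := i) e h).mfderiv_eq] at h4
  -- The chain rule gives the differential of the chart at `h • k_e`; it is moved to `k_e` by
  -- letting the base point vary along an equality.
  have h5 : ∀ m : BSManifold i, m = fixedPt i e → ∀ w : Fin n → ℂ,
      mfderiv 𝓘(ℝ, Fin n → ℂ) 𝓘(ℝ, Fin n → ℂ) (affineChart i e) m w =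
        tangentCoord (i := i) e w := by
    rintro _ rfl w
    rfl
  exact (h5 _ (smul_fixedPt e h) _).symm.trans
    ((DFunLike.congr_fun h1 v).symm.trans (DFunLike.congr_fun h4 v))

variable (i) in
/-- The affine coordinates on the tangent space are complex linear. -/
noncomputable def tangentCoordComplex (e : Fin n → Fin 2) :
    TangentSpace 𝓘(ℝ, Fin n → ℂ) (fixedPt i e) ≃ₗ[ℂ] (Fin n → ℂ) :=
  { (tangentCoord e).toLinearEquiv.toAddEquiv with
    -- Scalar multiplication on the tangent space was defined by transport along these coordinates.
    map_smul' := fun c v => (tangentCoord e).apply_symm_apply (c • tangentCoord e v) }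

variable (i) in
/-- The isotropy representation at the fixed point `e`. -/
noncomputable def isotropyRep (e : Fin n → Fin 2) : Representation ℂ (maxTorus N × Circle)
    (TangentSpace 𝓘(ℝ, Fin n → ℂ) (fixedPt i e)) where
  toFun h := (tangentCoordComplex i e).symm.conj (LinearMap.mulLeft ℂ (coordChar i e h))
  map_one' := by ext v; simp [LinearEquiv.conj_apply]
  map_mul' g h := by
    ext v
    simp [LinearEquiv.conj_apply]

lemma isotropyRep_apply (e : Fin n → Fin 2) (h : maxTorus N × Circle)
    (v : TangentSpace 𝓘(ℝ, Fin n → ℂ) (fixedPt i e)) :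
    isotropyRep i e h v =
      (tangentCoordComplex i e).symm (coordChar i e h * tangentCoordComplex i e v) := rfl

lemma isIsotropyRepresentation_isotropyRep (e : Fin n → Fin 2) :
    IsIsotropyRepresentation i e (isotropyRep i e) := by
  refine fun h => ⟨mdifferentiableAt_smul e h, fun v => ?_⟩
  rw [isotropyRep_apply]
  exact (tangentCoordComplex i e).symm_apply_eq.2 (tangentCoord_mfderiv_smul e h v).symm

lemma hasWeights_isotropyRep (e : Fin n → Fin 2) :
    HasWeights (isotropyRep i e) fun j => galleryPrefix i e j (-(simpleRoot (i j)).weight) := by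
  refine ⟨(Pi.basisFun ℂ (Fin n)).map (tangentCoordComplex i e).symm, fun X j => ?_⟩
  rw [isotropyRep_apply, Module.Basis.map_apply, LinearEquiv.apply_symm_apply, ← map_smul,
    ← coordChar_torusExp]
  congr 1
  ext l
  by_cases hl : l = j
  · subst hl; simp
  · simp [hl]

lemma det_mulLeft_pi {ι R : Type*} [Fintype ι] [CommRing R] (d : ι → R) :
    LinearMap.det (LinearMap.mulLeft R d) = ∏ j, d j := by
  classical
  have : LinearMap.mulLeft R d = Matrix.toLin' (Matrix.diagonal d) := by
    ext v j
    simp [Matrix.mulVec_diagonal]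
  rw [this, LinearMap.det_toLin', Matrix.det_diagonal]

/-- This is the derivative of `s ↦ e^{isb} w` at `0`, the infinitesimal action on one weight line.
-/
lemma tendsto_character_slope (b : ℝ) (w : ℂ) :
    Filter.Tendsto (fun s : ℝ => (s : ℂ)⁻¹ * (Complex.exp (Complex.I * (s * b : ℝ)) * w - w))
      (nhdsWithin 0 {0}ᶜ) (nhds (Complex.I * b * w)) := by
  have h : HasDerivAt (fun s : ℝ => Complex.exp (Complex.I * (s * b : ℝ)) * w)
      (Complex.I * b * w) 0 := by
    have h0 := ((((hasDerivAt_id (0 : ℝ)).mul_const b).ofReal_comp.const_mul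
      Complex.I).cexp).mul_const w
    simpa using h0
  have := hasDerivAt_iff_tendsto_slope_zero.1 h
  simpa [Complex.real_smul] using this

lemma isEquivariantEulerClass_isotropyRep (e : Fin n → Fin 2) :
    IsEquivariantEulerClass (isotropyRep i e) (∏ j, SymmetricAlgebra.ι ℝ (Weight N)
      (galleryPrefix i e j (-(simpleRoot (i j)).weight))) := by
  intro X
  have hχ := coordChar_torusExp (i := i) e
  -- Only the linearity of the weights matters from here on, so they are replaced by arbitrary
  -- linear forms.
  obtain ⟨γ, hγ⟩ : ∃ γ : Fin n → Weight N,
      ∀ j, galleryPrefix i e j (-(simpleRoot (i j)).weight) = γ j := ⟨_, fun _ => rfl⟩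
  simp only [hγ] at hχ ⊢
  set β : Fin n → ℝ := fun j => γ j X with hβ
  refine ⟨(tangentCoordComplex i e).symm.conj (LinearMap.mulLeft ℂ fun j => Complex.I * β j),
    fun v => ?_, ?_⟩
  · have hlim : Filter.Tendsto (fun s : ℝ => (s : ℂ)⁻¹ •
        (coordChar i e (torusExp (s • X)) * tangentCoordComplex i e v - tangentCoordComplex i e v))
        (nhdsWithin 0 {0}ᶜ)
        (nhds ((fun j => Complex.I * β j) * tangentCoordComplex i e v)) := by
      refine tendsto_pi_nhds.2 fun j => ?_
      simpa [hχ, hβ] using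
        tendsto_character_slope (β j) (tangentCoordComplex i e v j)
    -- The limit is computed coordinatewise; continuity of the inverse coordinates carries it to the
    -- tangent space.
    have hcont : Continuous (tangentCoordComplex i e).symm := (tangentCoord e).symm.continuous
    refine ((hcont.tendsto _).comp hlim).congr fun s => ?_
    simp [isotropyRep_apply]
  -- Since `-i · i = 1`, the normalised infinitesimal action is diagonal with the real entries
  -- `β_j(X)`, and its determinant is unchanged by conjugation.
  · have h1 : -Complex.I • (tangentCoordComplex i e).symm.conj
        (LinearMap.mulLeft ℂ fun j => Complex.I * β j) =
        (tangentCoordComplex i e).symm.conj (LinearMap.mulLeft ℂ fun j => (β j : ℂ)) := by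
      rw [← map_smul]
      congr 1
      ext v j
      simp [← mul_assoc]
    rw [h1, LinearEquiv.conj_apply, LinearMap.comp_assoc, LinearMap.det_conj, det_mulLeft_pi, ← Complex.ofReal_prod,
      map_prod]
    simp [evalSym, hβ]

end isotropy

end BottSamelson

theorem mainTheorem7 (N : ℕ) [N.AtLeastTwo] (n : ℕ) (i : Fin n → Fin N) (e : Fin n → Fin 2) :
    (∀ h : maxTorus N × Circle, h • fixedPt i e = fixedPt i e) ∧
    ∃ ρ : Representation ℂ (maxTorus N × Circle)
        (TangentSpace 𝓘(ℝ, Fin n → ℂ) (fixedPt i e)),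
      IsIsotropyRepresentation i e ρ ∧
      HasWeights ρ (fun j => galleryPrefix i e j (-(simpleRoot (i j)).weight)) ∧
      IsEquivariantEulerClass ρ
        (∏ j, SymmetricAlgebra.ι ℝ (Weight N) (galleryPrefix i e j (-(simpleRoot (i j)).weight))) :=
  ⟨smul_fixedPt e, isotropyRep i e, isIsotropyRepresentation_isotropyRep e,
    hasWeights_isotropyRep e, isEquivariantEulerClass_isotropyRep e⟩
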